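/- Let $\rho\in(-1,1)$, $\sigma_\varepsilon>0$, $c\in(0,\infty)$, and let $(\beta_j)_{j\ge1}$ be a real sequence with $\sum_{j=1}^\infty\beta_j^2<\infty$. Let $p=p_n$ be positive integers (for large $n$) with $p\to\infty$ and $p/n\to c$ as $n\to\infty$. For each $n$ consider the linear regression model $Y=\mathbb{X}\beta+\varepsilon$, where $\beta=(\beta_1,\dots,\beta_p)'$, the rows of $\mathbb{X}\in\mathbb{R}^{n\times p}$ are i.i.d. $\mathcal{N}_p(0,\Sigma)$ with $\Sigma=(\rho^{|i-j|})_{i,j=1}^p$ (so $\Sigma=I_p$ if $\rho=0$), and $\varepsilon\sim\mathcal{N}(0,\sigma_\varepsilon^2 I_n)$ is independent of $\mathbb{X}$. Put $$\kappa_{1,p}=\sum_{k,l=1}^p\beta_k\beta_l\rho^{|k-l|},\qquad \kappa_{2,p}=\sum_{k=1}^p\Big(\sum_{l=1}^p\beta_l\rho^{|k-l|}\Big)^2,\qquad \kappa_{3,p}=\sum_{k,l,j,j'=1}^p\beta_j\beta_{j'}\rho^{|k-j|}\rho^{|l-j'|}\rho^{|k-l|}.$$ Then the limits $\kappa_i=\lim_{p\to\infty}\kappa_{i,p}$,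 $i=1,2,3$, exist and are finite, and, as $n\to\infty$, $$\frac{\|\mathbb{X}'Y\|_2^2-n^2\kappa_{2,p}-pn(\kappa_{1,p}+\sigma_\varepsilon^2)}{n^{3/2}}\ \xrightarrow{d}\ \mathcal{N}(0,s^2),$$ where $$s^2=4\kappa_2^2+4(\kappa_1+\sigma_\varepsilon^2)(2\kappa_2c+\kappa_3)+2c(\kappa_1+\sigma_\varepsilon^2)^2\Big(c+\frac{1+\rho^2}{1-\rho^2}\Big)\ \ge 0 .$$ -/

import Mathlib

open MeasureTheory ProbabilityTheory Filter Topology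
open scoped Matrix

noncomputable section

/-- The Kac–Murdock–Szegő matrix `(ρ ^ |i - j|)` of size `p × p`; it is the identity for `ρ = 0`
since `0 ^ 0 = 1`. -/
def kmsMatrix (ρ : ℝ) (p : ℕ) : Matrix (Fin p) (Fin p) ℝ :=
  Matrix.of fun i j => ρ ^ ((i : ℤ) - (j : ℤ)).natAbs

/-- The first `p` coefficients of the sequence; `β 0, β 1, …` are the `β_1, β_2, …` of the text. -/
def coeffVec (β : ℕ → ℝ) (p : ℕ) : Fin p → ℝ := fun j => β j

/-- `κ_{1,p} = ∑_{k,l} β_k β_l ρ^{|k-l|}`. -/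
def kappa1 (β : ℕ → ℝ) (ρ : ℝ) (p : ℕ) : ℝ :=
  ∑ k : Fin p, ∑ l : Fin p, β k * β l * ρ ^ ((k : ℤ) - (l : ℤ)).natAbs

/-- `κ_{2,p} = ∑_k (∑_l β_l ρ^{|k-l|})²`. -/
def kappa2 (β : ℕ → ℝ) (ρ : ℝ) (p : ℕ) : ℝ :=
  ∑ k : Fin p, (∑ l : Fin p, β l * ρ ^ ((k : ℤ) - (l : ℤ)).natAbs) ^ 2

/-- `κ_{3,p} = ∑_{k,l,j,j'} β_j β_{j'} ρ^{|k-j|} ρ^{|l-j'|} ρ^{|k-l|}`. -/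
def kappa3 (β : ℕ → ℝ) (ρ : ℝ) (p : ℕ) : ℝ :=
  ∑ k : Fin p, ∑ l : Fin p, ∑ j : Fin p, ∑ j' : Fin p,
    β j * β j' * ρ ^ ((k : ℤ) - (j : ℤ)).natAbs * ρ ^ ((l : ℤ) - (j' : ℤ)).natAbs *
      ρ ^ ((k : ℤ) - (l : ℤ)).natAbs

/-- The linear regression model `Y = X β + ε` with `n` observations and `p` predictors: the rows of
the design `X` are i.i.d. `N_p(0, Σ)` with `Σ` the KMS matrix, the error vector `ε` is
`N_n(0, σ² I_n)`, and the design is independent of the errors. -/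
structure IsKMSRegression {Ω : Type*} [MeasurableSpace Ω] (P : Measure Ω) {n p : ℕ}
    (ρ σ : ℝ) (β : Fin p → ℝ) (X : Ω → Fin n → Fin p → ℝ) (ε Y : Ω → Fin n → ℝ) : Prop where
  rows_law : ∀ i, HasLaw (fun ω => WithLp.toLp 2 (X ω i))
    (multivariateGaussian (0 : EuclideanSpace ℝ (Fin p)) (kmsMatrix ρ p)) P
  rows_indep : iIndepFun (fun i ω => X ω i) P
  errors_law : HasLaw (fun ω => WithLp.toLp 2 (ε ω))
    (multivariateGaussian (0 : EuclideanSpace ℝ (Fin n)) (σ ^ 2 • (1 : Matrix (Fin n) (Fin n) ℝ))) P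
  design_indep_errors : IndepFun X ε P
  model : ∀ ω, Y ω = Matrix.of (X ω) *ᵥ β + ε ω

/-- `‖X' y‖₂²`, with the Euclidean norm. -/
def sqNormXtY {n p : ℕ} (X : Fin n → Fin p → ℝ) (y : Fin n → ℝ) : ℝ :=
  ‖WithLp.toLp 2 ((Matrix.of X)ᵀ *ᵥ y)‖ ^ 2

/-- The limiting variance
`s² = 4 κ₂² + 4 (κ₁ + σ²) (2 κ₂ c + κ₃) + 2 c (κ₁ + σ²)² (c + (1 + ρ²) / (1 - ρ²))`. -/
def limitVar (κ₁ κ₂ κ₃ σ c ρ : ℝ) : ℝ :=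
  4 * κ₂ ^ 2 + 4 * (κ₁ + σ ^ 2) * (2 * κ₂ * c + κ₃) +
    2 * c * (κ₁ + σ ^ 2) ^ 2 * (c + (1 + ρ ^ 2) / (1 - ρ ^ 2))

end

/-!
Regress each row `xᵢ ∼ N(0, Σ)` of the design on its response `yᵢ = β · xᵢ + εᵢ ∼ N(0, τ²)`, where
`τ² = κ₁ + σ²`: the residual `rᵢ = xᵢ - (yᵢ / τ²) Σβ` is independent of `yᵢ` and has law `N(0, S)`
with `S = Σ - τ⁻² Σβ (Σβ)'` (`map_residualPair`). Hence `X'Y = ∑ᵢ yᵢ rᵢ + (‖Y‖² / τ²) Σβ`, and, given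
`Y`, the sum of residuals is distributed as `‖Y‖ u` with `u ∼ N(0, S)` (`map_sum_smul_pair`).
Diagonalizing `S` expresses the law of `‖X'Y‖²` through independent standard Gaussian variables:
with `q = ‖Y‖² / τ²` a sum of `n` squares,
`‖X'Y‖² = τ² q ‖u‖² + 2 τ q ^ (3 / 2) ⟨Σβ, u⟩ + κ₂ q²`
(`IsKMSRegression.exists_map_sqNormXtY_eq`).

Since `q = n + O(√n)` and `‖u‖² = tr S + O(√n)`, the normalized statistic is, up to an error of size
`O(n ^ (-1/2))` in `L¹`, a sum of independent terms `a g + d (g² - 1)` with `g` standard Gaussian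
(`norm_integral_cexp_quadStat_sub_le`). The characteristic function of such a term is explicit. The
coefficients `d` are uniformly `O(n ^ (-1/2))` because `S` is bounded by `Σ`, which is bounded on `ℓ²`
by Schur's test, so the product of these characteristic functions converges to a Gaussian one
as soon as `∑ (a² + 2 d²)` converges (`tendsto_prod_charFun_quadratic`). Lévy's continuity theorem
then gives the claim. The limiting variance involves `tr S² / n`, which differs from `tr Σ² / n` by
`O(1 / n)`, and `tr Σ² / p → (1 + ρ²) / (1 - ρ²)` by Cesàro averaging.
-/

/-! ### The Kac–Murdock–Szegő matrix -/

/-- The entries `ρ ^ |i - j|` of the infinite Kac–Murdock–Szegő matrix. -/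
def kmsEntry (ρ : ℝ) (i j : ℕ) : ℝ := ρ ^ ((i : ℤ) - (j : ℤ)).natAbs

lemma kmsMatrix_apply (ρ : ℝ) {p : ℕ} (i j : Fin p) : kmsMatrix ρ p i j = kmsEntry ρ i j := rfl

lemma kmsEntry_comm (ρ : ℝ) (i j : ℕ) : kmsEntry ρ i j = kmsEntry ρ j i := by
  unfold kmsEntry
  congr 1
  omega

lemma kmsEntry_of_le (ρ : ℝ) {i j : ℕ} (h : j ≤ i) : kmsEntry ρ i j = ρ ^ (i - j) := by
  unfold kmsEntry
  congr 1
  omega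

lemma abs_kmsEntry (ρ : ℝ) (i j : ℕ) : |kmsEntry ρ i j| = kmsEntry |ρ| i j := abs_pow _ _

lemma kmsEntry_nonneg {r : ℝ} (hr : 0 ≤ r) (i j : ℕ) : 0 ≤ kmsEntry r i j := pow_nonneg hr _

lemma geom_sum_le_inv {r : ℝ} (hr : 0 ≤ r) (hr1 : r < 1) (m : ℕ) :
    ∑ j ∈ Finset.range m, r ^ j ≤ (1 - r)⁻¹ := by
  rw [← tsum_geometric_of_lt_one hr hr1]
  exact (summable_geometric_of_lt_one hr hr1).sum_le_tsum _ fun i _ => pow_nonneg hr i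

/-- Row sums of the Kac–Murdock–Szegő matrix are bounded, uniformly in the row and the size: each
side of the diagonal contributes at most a geometric series. -/
lemma sum_kmsEntry_le {r : ℝ} (hr : 0 ≤ r) (hr1 : r < 1) (i p : ℕ) :
    ∑ j : Fin p, kmsEntry r i j ≤ 2 * (1 - r)⁻¹ := by
  rw [Fin.sum_univ_eq_sum_range (fun j => kmsEntry r i j) p]
  have h1 : ∑ j ∈ Finset.range (i + 1), kmsEntry r i j ≤ (1 - r)⁻¹ := by
    rw [← Finset.sum_range_reflect]
    refine le_trans (le_of_eq (Finset.sum_congr rfl fun j hj => ?_)) (geom_sum_le_inv hr hr1 (i + 1))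
    rw [Finset.mem_range] at hj
    rw [kmsEntry_of_le r (by omega)]
    congr 1
    omega
  have h2 : ∑ j ∈ Finset.Ico i p, kmsEntry r i j ≤ (1 - r)⁻¹ := by
    rw [Finset.sum_Ico_eq_sum_range]
    refine le_trans (le_of_eq (Finset.sum_congr rfl fun j _ => ?_)) (geom_sum_le_inv hr hr1 (p - i))
    rw [kmsEntry_comm, kmsEntry_of_le r (by omega)]
    congr 1
    omega
  have hsub : Finset.range p ⊆ Finset.range (i + 1) ∪ Finset.Ico i p := by
    intro j hj
    simp only [Finset.mem_union, Finset.mem_range, Finset.mem_Ico] at hj ⊢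
    omega
  have h3 := Finset.sum_le_sum_of_subset_of_nonneg hsub
    (f := fun j => kmsEntry r i j) fun j _ _ => kmsEntry_nonneg hr i j
  have h4 := Finset.sum_union_inter (s₁ := Finset.range (i + 1)) (s₂ := Finset.Ico i p)
    (f := fun j => kmsEntry r i j)
  have h5 : 0 ≤ ∑ j ∈ Finset.range (i + 1) ∩ Finset.Ico i p, kmsEntry r i j :=
    Finset.sum_nonneg fun j _ => kmsEntry_nonneg hr i j
  linarith

/-- Schur's test: the Kac–Murdock–Szegő matrix is bounded on `ℓ²`, uniformly in its size. -/
lemma sum_sq_sum_kmsEntry_le {ρ : ℝ} (hρ : |ρ| < 1) {p : ℕ} (x : Fin p → ℝ) :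
    ∑ i : Fin p, (∑ j : Fin p, x j * kmsEntry ρ i j) ^ 2 ≤
      (2 * (1 - |ρ|)⁻¹) ^ 2 * ∑ i, x i ^ 2 := by
  set C := 2 * (1 - |ρ|)⁻¹ with hC
  have hC0 : 0 ≤ C := by
    have : 0 < 1 - |ρ| := by linarith
    positivity
  have h1 (i : Fin p) : (∑ j : Fin p, x j * kmsEntry ρ i j) ^ 2 ≤
      C * ∑ j : Fin p, kmsEntry |ρ| i j * x j ^ 2 := by
    refine (Finset.sum_sq_le_sum_mul_sum_of_sq_le_mul Finset.univ
      (f := fun j : Fin p => kmsEntry |ρ| i j) (g := fun j : Fin p => kmsEntry |ρ| i j * x j ^ 2)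
      (fun j _ => kmsEntry_nonneg (abs_nonneg _) _ _)
      (fun j _ => mul_nonneg (kmsEntry_nonneg (abs_nonneg _) _ _) (sq_nonneg _))
      (fun j _ => ?_)).trans ?_
    · refine le_of_eq ?_
      rw [← abs_kmsEntry, mul_pow, ← sq_abs (kmsEntry ρ i j)]
      ring
    · exact mul_le_mul_of_nonneg_right (sum_kmsEntry_le (abs_nonneg _) hρ _ _)
        (Finset.sum_nonneg fun j _ => mul_nonneg (kmsEntry_nonneg (abs_nonneg _) _ _) (sq_nonneg _))
  calc ∑ i : Fin p, (∑ j : Fin p, x j * kmsEntry ρ i j) ^ 2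
      ≤ ∑ i : Fin p, C * ∑ j : Fin p, kmsEntry |ρ| i j * x j ^ 2 :=
        Finset.sum_le_sum fun i _ => h1 i
    _ = C * ∑ j : Fin p, (∑ i : Fin p, kmsEntry |ρ| j i) * x j ^ 2 := by
        rw [← Finset.mul_sum, Finset.sum_comm]
        simp_rw [Finset.sum_mul, fun i j : Fin p => kmsEntry_comm |ρ| (i : ℕ) (j : ℕ)]
    _ ≤ C * ∑ j : Fin p, C * x j ^ 2 := by
        gcongr with j _
        exact sum_kmsEntry_le (abs_nonneg _) hρ _ _
    _ = C ^ 2 * ∑ i, x i ^ 2 := by rw [← Finset.mul_sum]; ring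

lemma sum_mul_sum_kmsEntry_le {ρ : ℝ} (hρ : |ρ| < 1) {p : ℕ} (x : Fin p → ℝ) :
    ∑ i : Fin p, x i * ∑ j : Fin p, x j * kmsEntry ρ i j ≤
      2 * (1 - |ρ|)⁻¹ * ∑ i, x i ^ 2 := by
  have h := sum_sq_sum_kmsEntry_le hρ x
  have hC0 : 0 < 2 * (1 - |ρ|)⁻¹ := by
    have : 0 < 1 - |ρ| := by linarith
    positivity
  set C := 2 * (1 - |ρ|)⁻¹ with hC
  have h1 : ∑ i : Fin p, C * (x i * ∑ j : Fin p, x j * kmsEntry ρ i j) ≤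
      ∑ i : Fin p, (C ^ 2 * x i ^ 2 + (∑ j : Fin p, x j * kmsEntry ρ i j) ^ 2) / 2 :=
    Finset.sum_le_sum fun i _ => by
      nlinarith [sq_nonneg (C * x i - ∑ j : Fin p, x j * kmsEntry ρ i j)]
  rw [← Finset.mul_sum, ← Finset.sum_div, Finset.sum_add_distrib, ← Finset.mul_sum] at h1
  nlinarith

lemma kmsMatrix_isHermitian (ρ : ℝ) (p : ℕ) : (kmsMatrix ρ p).IsHermitian := by
  ext i j
  simp [kmsMatrix_apply, kmsEntry_comm ρ (j : ℕ)]

/-- If `Z` is a stationary autoregression with autocovariances `ρ ^ |i - j|`, then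
`∑ᵢ xᵢ ρ ^ (p - i)` is the covariance of `∑ᵢ xᵢ Zᵢ` with the next value `Z_p`, and the inequality is
Cauchy–Schwarz. This strengthening of nonnegativity is what makes the induction on `p` work. -/
lemma sq_sum_mul_pow_le {ρ : ℝ} (hρ : |ρ| ≤ 1) {p : ℕ} (x : Fin p → ℝ) :
    (∑ i : Fin p, x i * ρ ^ (p - i : ℕ)) ^ 2 ≤
      ∑ i : Fin p, ∑ j : Fin p, x i * x j * kmsEntry ρ i j := by
  induction p with
  | zero => simp
  | succ p ih =>
    have ih := ih fun i => x i.castSucc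
    set q := ∑ i : Fin p, ∑ j : Fin p, x i.castSucc * x j.castSucc * kmsEntry ρ i j
    set w := ∑ i : Fin p, x i.castSucc * ρ ^ (p - i : ℕ) with hw
    set y := x (Fin.last p)
    have h1 : ∑ i : Fin (p + 1), x i * ρ ^ (p + 1 - i : ℕ) = ρ * (w + y) := by
      rw [Fin.sum_univ_castSucc, mul_add, hw, Finset.mul_sum]
      congr 1
      · refine Finset.sum_congr rfl fun i _ => ?_
        have : p + 1 - (i : ℕ) = (p - i) + 1 := by omega
        simp only [Fin.val_castSucc, this, pow_succ]
        ring
      · simp [y, mul_comm]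
    have h2 : ∑ i : Fin (p + 1), ∑ j : Fin (p + 1), x i * x j * kmsEntry ρ i j =
        q + 2 * y * w + y ^ 2 := by
      have e1 (i : Fin p) : kmsEntry ρ i p = ρ ^ (p - i : ℕ) := by
        rw [kmsEntry_comm, kmsEntry_of_le ρ i.isLt.le]
      have e2 (i : Fin p) : kmsEntry ρ p i = ρ ^ (p - i : ℕ) := kmsEntry_of_le ρ i.isLt.le
      have e3 : kmsEntry ρ p p = 1 := by simp [kmsEntry]
      simp only [Fin.sum_univ_castSucc, Fin.val_castSucc, Fin.val_last, Finset.sum_add_distrib,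
        e1, e2, e3]
      have e4 : ∑ i : Fin p, x i.castSucc * x (Fin.last p) * ρ ^ (p - i : ℕ) = y * w := by
        rw [hw, Finset.mul_sum]
        exact Finset.sum_congr rfl fun i _ => by simp only [y]; ring
      have e5 : ∑ i : Fin p, x (Fin.last p) * x i.castSucc * ρ ^ (p - i : ℕ) = y * w := by
        rw [hw, Finset.mul_sum]
        exact Finset.sum_congr rfl fun i _ => by simp only [y]; ring
      rw [e4, e5]
      ring
    rw [h1, h2, mul_pow]
    have h3 : ρ ^ 2 ≤ 1 := by rw [← sq_abs]; nlinarith [abs_nonneg ρ]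
    nlinarith [mul_nonneg (sub_nonneg.2 h3) (sq_nonneg (w + y))]

lemma dotProduct_kmsMatrix_mulVec (ρ : ℝ) {p : ℕ} (x y : Fin p → ℝ) :
    x ⬝ᵥ kmsMatrix ρ p *ᵥ y = ∑ i : Fin p, ∑ j : Fin p, x i * y j * kmsEntry ρ i j := by
  simp only [dotProduct, Matrix.mulVec, kmsMatrix_apply, Finset.mul_sum]
  exact Finset.sum_congr rfl fun i _ => Finset.sum_congr rfl fun j _ => by ring

lemma kmsMatrix_posSemidef {ρ : ℝ} (hρ : |ρ| ≤ 1) (p : ℕ) : (kmsMatrix ρ p).PosSemidef := by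
  refine Matrix.PosSemidef.of_dotProduct_mulVec_nonneg (kmsMatrix_isHermitian ρ p) fun x => ?_
  rw [star_trivial, dotProduct_kmsMatrix_mulVec]
  exact (sq_nonneg _).trans (sq_sum_mul_pow_le hρ x)

lemma dotProduct_kmsMatrix_mulVec_le {ρ : ℝ} (hρ : |ρ| < 1) {p : ℕ} (x : Fin p → ℝ) :
    x ⬝ᵥ kmsMatrix ρ p *ᵥ x ≤ 2 * (1 - |ρ|)⁻¹ * (x ⬝ᵥ x) := by
  have h := sum_mul_sum_kmsEntry_le hρ x
  rw [dotProduct_kmsMatrix_mulVec]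
  simp only [dotProduct, ← sq]
  refine le_trans (le_of_eq ?_) h
  simp_rw [Finset.mul_sum, mul_assoc]

/-! ### The functionals `κ₁`, `κ₂`, `κ₃` -/

lemma kappa1_eq_dotProduct (β : ℕ → ℝ) (ρ : ℝ) (p : ℕ) :
    kappa1 β ρ p = coeffVec β p ⬝ᵥ kmsMatrix ρ p *ᵥ coeffVec β p := by
  rw [dotProduct_kmsMatrix_mulVec]
  rfl

lemma kmsMatrix_mulVec_apply (ρ : ℝ) {p : ℕ} (x : Fin p → ℝ) (k : Fin p) :
    (kmsMatrix ρ p *ᵥ x) k = ∑ l : Fin p, x l * kmsEntry ρ k l := by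
  simp only [dotProduct, Matrix.mulVec, kmsMatrix_apply, mul_comm]

lemma kappa2_eq_dotProduct (β : ℕ → ℝ) (ρ : ℝ) (p : ℕ) :
    kappa2 β ρ p =
      (kmsMatrix ρ p *ᵥ coeffVec β p) ⬝ᵥ (kmsMatrix ρ p *ᵥ coeffVec β p) := by
  simp only [dotProduct, ← sq, kmsMatrix_mulVec_apply]
  rfl

lemma kappa3_eq_dotProduct (β : ℕ → ℝ) (ρ : ℝ) (p : ℕ) :
    kappa3 β ρ p =
      (kmsMatrix ρ p *ᵥ coeffVec β p) ⬝ᵥ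
        kmsMatrix ρ p *ᵥ (kmsMatrix ρ p *ᵥ coeffVec β p) := by
  rw [dotProduct_kmsMatrix_mulVec]
  simp only [kmsMatrix_mulVec_apply]
  refine Finset.sum_congr rfl fun k _ => Finset.sum_congr rfl fun l _ => ?_
  rw [Finset.sum_mul_sum, Finset.sum_mul]
  refine Finset.sum_congr rfl fun j _ => ?_
  rw [Finset.sum_mul]
  refine Finset.sum_congr rfl fun j' _ => ?_
  simp only [kmsEntry, coeffVec]
  ring

lemma sum_coeffVec_sq_le {β : ℕ → ℝ} (hβ : Summable fun j => β j ^ 2) (p : ℕ) :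
    ∑ i : Fin p, |β i| ^ 2 ≤ ∑' j, β j ^ 2 := by
  simp_rw [sq_abs]
  rw [Fin.sum_univ_eq_sum_range (fun j => β j ^ 2) p]
  exact hβ.sum_le_tsum _ fun i _ => sq_nonneg _

/-- If the absolute sums over an exhausting sequence of finite sets stay bounded, then the sums
along that sequence converge. -/
lemma exists_tendsto_sum_of_sum_abs_le {ι : Type*} (f : ι → ℝ) (s : ℕ → Finset ι)
    (hs : Monotone s) (hs' : ∀ x, ∃ n, x ∈ s n) (B : ℝ) (hB : ∀ n, ∑ x ∈ s n, |f x| ≤ B) :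
    ∃ a, Tendsto (fun n => ∑ x ∈ s n, f x) atTop (𝓝 a) := by
  have ht : Tendsto s atTop atTop := tendsto_atTop_finset_of_monotone hs hs'
  have hsum : Summable fun x => |f x| := by
    refine summable_of_sum_le (c := B) (fun x => abs_nonneg _) fun u => ?_
    obtain ⟨n, hn⟩ := (ht.eventually (eventually_ge_atTop u)).exists
    exact (Finset.sum_le_sum_of_subset_of_nonneg hn fun x _ _ => abs_nonneg _).trans (hB n)
  exact ⟨_, hsum.of_abs.hasSum.comp ht⟩

lemma exists_tendsto_kappa1 {ρ : ℝ} (hρ : |ρ| < 1) {β : ℕ → ℝ} (hβ : Summable fun j => β j ^ 2) :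
    ∃ κ, Tendsto (kappa1 β ρ) atTop (𝓝 κ) := by
  have hrange := Finset.range_mono
  have hlim := exists_tendsto_sum_of_sum_abs_le
    (fun x : ℕ × ℕ => β x.1 * β x.2 * kmsEntry ρ x.1 x.2)
    (fun p => Finset.range p ×ˢ Finset.range p)
    (fun m n h => Finset.product_subset_product (hrange h) (hrange h))
    (fun x => ⟨x.1 + x.2 + 1, by simp only [Finset.mem_product, Finset.mem_range]; omega⟩)
    (2 * (1 - |ρ|)⁻¹ * ∑' j, β j ^ 2)
  refine Exists.imp (fun a ha => ha.congr fun p => ?_) (hlim fun p => ?_)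
  rotate_left
  · rw [Finset.sum_product]
    simp only [kappa1, Finset.sum_range, kmsEntry]
  · have h := sum_mul_sum_kmsEntry_le (ρ := |ρ|) (by rwa [abs_abs]) (fun i : Fin p => |β i|)
    rw [abs_abs] at h
    have h0 : 0 ≤ 2 * (1 - |ρ|)⁻¹ := by
      have : 0 < 1 - |ρ| := by linarith
      positivity
    refine le_trans (le_of_eq ?_)
      (h.trans (mul_le_mul_of_nonneg_left (sum_coeffVec_sq_le hβ p) h0))
    rw [Finset.sum_product]
    simp only [Finset.sum_range, abs_mul, abs_kmsEntry, Finset.mul_sum, mul_assoc]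

lemma exists_tendsto_kappa2 {ρ : ℝ} (hρ : |ρ| < 1) {β : ℕ → ℝ} (hβ : Summable fun j => β j ^ 2) :
    ∃ κ, Tendsto (kappa2 β ρ) atTop (𝓝 κ) := by
  have hrange := Finset.range_mono
  have hlim := exists_tendsto_sum_of_sum_abs_le
    (fun x : ℕ × ℕ × ℕ => β x.2.1 * kmsEntry ρ x.1 x.2.1 * (β x.2.2 * kmsEntry ρ x.1 x.2.2))
    (fun p => Finset.range p ×ˢ Finset.range p ×ˢ Finset.range p)
    (fun m n h => Finset.product_subset_product (hrange h)
      (Finset.product_subset_product (hrange h) (hrange h)))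
    (fun x => ⟨x.1 + x.2.1 + x.2.2 + 1, by
      simp only [Finset.mem_product, Finset.mem_range]; omega⟩)
    ((2 * (1 - |ρ|)⁻¹) ^ 2 * ∑' j, β j ^ 2)
  refine Exists.imp (fun a ha => ha.congr fun p => ?_) (hlim fun p => ?_)
  rotate_left
  · simp only [Finset.sum_product, kappa2, Finset.sum_range, sq, Finset.sum_mul_sum, kmsEntry]
  · have h := sum_sq_sum_kmsEntry_le (ρ := |ρ|) (by rwa [abs_abs]) (fun i : Fin p => |β i|)
    rw [abs_abs] at h
    refine le_trans (le_of_eq ?_)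
      (h.trans (mul_le_mul_of_nonneg_left (sum_coeffVec_sq_le hβ p) (sq_nonneg _)))
    simp only [Finset.sum_product, Finset.sum_range, abs_mul, abs_kmsEntry]
    refine Finset.sum_congr rfl fun i _ => ?_
    rw [sq, Finset.sum_mul_sum]

lemma exists_tendsto_kappa3 {ρ : ℝ} (hρ : |ρ| < 1) {β : ℕ → ℝ} (hβ : Summable fun j => β j ^ 2) :
    ∃ κ, Tendsto (kappa3 β ρ) atTop (𝓝 κ) := by
  have hrange := Finset.range_mono
  have hlim := exists_tendsto_sum_of_sum_abs_le
    (fun x : ℕ × ℕ × ℕ × ℕ => β x.2.2.1 * β x.2.2.2 * kmsEntry ρ x.1 x.2.2.1 *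
      kmsEntry ρ x.2.1 x.2.2.2 * kmsEntry ρ x.1 x.2.1)
    (fun p => Finset.range p ×ˢ Finset.range p ×ˢ Finset.range p ×ˢ Finset.range p)
    (fun m n h => Finset.product_subset_product (hrange h)
      (Finset.product_subset_product (hrange h)
        (Finset.product_subset_product (hrange h) (hrange h))))
    (fun x => ⟨x.1 + x.2.1 + x.2.2.1 + x.2.2.2 + 1, by
      simp only [Finset.mem_product, Finset.mem_range]; omega⟩)
    (2 * (1 - |ρ|)⁻¹ * ((2 * (1 - |ρ|)⁻¹) ^ 2 * ∑' j, β j ^ 2))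
  refine Exists.imp (fun a ha => ha.congr fun p => ?_) (hlim fun p => ?_)
  rotate_left
  · simp only [Finset.sum_product, kappa3, Finset.sum_range, kmsEntry]
  · have h0 : 0 ≤ 2 * (1 - |ρ|)⁻¹ := by
      have : 0 < 1 - |ρ| := by linarith
      positivity
    have h := sum_sq_sum_kmsEntry_le (ρ := |ρ|) (by rwa [abs_abs]) (fun i : Fin p => |β i|)
    have h' := sum_mul_sum_kmsEntry_le (ρ := |ρ|) (by rwa [abs_abs])
      (fun i : Fin p => ∑ j : Fin p, |β j| * kmsEntry |ρ| i j)
    rw [abs_abs] at h h'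
    refine le_trans (le_of_eq ?_) (h'.trans (mul_le_mul_of_nonneg_left
      (h.trans (mul_le_mul_of_nonneg_left (sum_coeffVec_sq_le hβ p) (sq_nonneg _))) h0))
    simp only [Finset.sum_product, Finset.sum_range, abs_mul, abs_kmsEntry]
    refine Finset.sum_congr rfl fun k _ => ?_
    rw [Finset.mul_sum]
    refine Finset.sum_congr rfl fun l _ => ?_
    rw [← mul_assoc, Finset.sum_mul_sum, Finset.sum_mul]
    refine Finset.sum_congr rfl fun j _ => ?_
    rw [Finset.sum_mul]
    exact Finset.sum_congr rfl fun j' _ => by ring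

/-- The normalised trace of the square of the Kac–Murdock–Szegő matrix, by Cesàro averaging: adding
a row and a column adds `1 + 2 ∑_{m ≤ p} r ^ m` to the total sum of the entries. -/
lemma tendsto_sum_kmsEntry_div {r : ℝ} (hr : 0 ≤ r) (hr1 : r < 1) :
    Tendsto (fun p : ℕ => (∑ i : Fin p, ∑ j : Fin p, kmsEntry r i j) / p) atTop
      (𝓝 ((1 + r) / (1 - r))) := by
  set F : ℕ → ℝ := fun p => ∑ i : Fin p, ∑ j : Fin p, kmsEntry r i j with hF
  have hstep (p : ℕ) : F (p + 1) - F p = 2 * r * (∑ m ∈ Finset.range p, r ^ m) + 1 := by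
    have e1 (i : Fin p) : kmsEntry r i p = r ^ (p - i : ℕ) := by
      rw [kmsEntry_comm, kmsEntry_of_le r i.isLt.le]
    have e2 (i : Fin p) : kmsEntry r p i = r ^ (p - i : ℕ) := kmsEntry_of_le r i.isLt.le
    have e3 : kmsEntry r p p = 1 := by simp [kmsEntry]
    have e4 : ∑ i : Fin p, r ^ (p - i : ℕ) = r * ∑ m ∈ Finset.range p, r ^ m := by
      rw [Fin.sum_univ_eq_sum_range (fun i => r ^ (p - i)) p, ← Finset.sum_range_reflect,
        Finset.mul_sum]
      refine Finset.sum_congr rfl fun i hi => ?_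
      rw [Finset.mem_range] at hi
      rw [← pow_succ']
      congr 1
      omega
    simp only [hF, Fin.sum_univ_castSucc, Fin.val_castSucc, Fin.val_last,
      Finset.sum_add_distrib, e1, e2, e3, e4]
    ring
  have h1 : Tendsto (fun p => F (p + 1) - F p) atTop (𝓝 ((1 + r) / (1 - r))) := by
    simp_rw [hstep]
    have := ((hasSum_geometric_of_lt_one hr hr1).tendsto_sum_nat.const_mul (2 * r)).add_const 1
    convert this using 2
    have : 1 - r ≠ 0 := by linarith
    field_simp
    ring
  have h2 := h1.cesaro
  refine h2.congr fun p => ?_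
  rw [Finset.sum_range_sub, div_eq_inv_mul]
  simp [hF]

/-! ### Characteristic functions of quadratic polynomials in Gaussian variables -/

open Complex in
/-- The characteristic function of `a g + d (g² - 1)` for a standard Gaussian `g`. -/
lemma integral_cexp_quadratic_gaussianReal (a d t : ℝ) :
    ∫ x, cexp ((t * (a * x + d * (x ^ 2 - 1)) : ℝ) * I) ∂(gaussianReal 0 1) =
      cexp (-(log (1 - 2 * t * d * I) + 2 * t * d * I) / 2 -
        t ^ 2 * a ^ 2 / (2 * (1 - 2 * t * d * I))) := by
  set z : ℂ := 2 * t * d * I with hz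
  have hzre : (1 - z).re = 1 := by simp [hz]
  have hz0 : 1 - z ≠ 0 := fun h => by simp [h] at hzre
  have hpi : (0 : ℝ) < 2 * Real.pi := by positivity
  have hpi0 : ((2 * Real.pi : ℝ) : ℂ) ≠ 0 := by exact_mod_cast hpi.ne'
  rw [integral_gaussianReal_eq_integral_smul one_ne_zero]
  have h1 (x : ℝ) : gaussianPDFReal 0 1 x • cexp ((t * (a * x + d * (x ^ 2 - 1)) : ℝ) * I) =
      ((√(2 * Real.pi))⁻¹ : ℝ) *
        cexp (-((1 - z) / 2) * x ^ 2 + (t * a * I) * x + (-(z / 2))) := by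
    rw [gaussianPDFReal, real_smul]
    push_cast
    rw [mul_assoc, ← Complex.exp_add]
    congr 2
    · simp
    · simp [hz]; ring
  simp_rw [h1]
  rw [integral_const_mul, integral_cexp_quadratic (by simp [hz])]
  have h2 : (Real.pi / - -((1 - z) / 2) : ℂ) = ((2 * Real.pi : ℝ) : ℂ) * (1 - z)⁻¹ := by
    push_cast
    field_simp
  have hsqrt : ((√(2 * Real.pi))⁻¹ : ℝ) * ((2 * Real.pi : ℝ) : ℂ) ^ (1 / 2 : ℂ) = 1 := by
    rw [Real.sqrt_eq_rpow, ← Real.rpow_neg hpi.le, Complex.ofReal_cpow hpi.le,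
      ← Complex.cpow_add _ _ hpi0]
    simp
  have hslit : 1 - z ∈ slitPlane := Or.inl (by rw [hzre]; exact one_pos)
  have hmul : (((2 * Real.pi : ℝ) : ℂ) * (1 - z)⁻¹) ^ (1 / 2 : ℂ) =
      ((2 * Real.pi : ℝ) : ℂ) ^ (1 / 2 : ℂ) * (1 - z)⁻¹ ^ (1 / 2 : ℂ) := by
    rw [cpow_def_of_ne_zero (mul_ne_zero hpi0 (inv_ne_zero hz0)), cpow_def_of_ne_zero hpi0,
      cpow_def_of_ne_zero (inv_ne_zero hz0), log_ofReal_mul hpi (inv_ne_zero hz0), add_mul,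
      Complex.exp_add, ofReal_log hpi.le]
  rw [h2, hmul, ← mul_assoc, ← mul_assoc, hsqrt, one_mul,
    Complex.cpow_def_of_ne_zero (inv_ne_zero hz0), Complex.log_inv _ (slitPlane_arg_ne_pi hslit),
    ← Complex.exp_add]
  congr 1
  have : (t * a * I : ℂ) ^ 2 = - (t ^ 2 * a ^ 2) := by
    rw [mul_pow, I_sq]; ring
  rw [this]
  field_simp
  ring

open Complex in
/-- Second-order expansion of the exponent of the characteristic function of `a g + d (g² - 1)`.
The error is linear in `d`, so that only the quadratic coefficients need to be uniformly small. -/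
lemma norm_quadratic_exponent_sub_le {a d t : ℝ} (h : |2 * t * d| ≤ 1 / 2) :
    ‖(-(log (1 - 2 * t * d * I) + 2 * t * d * I) / 2 -
        t ^ 2 * a ^ 2 / (2 * (1 - 2 * t * d * I))) - (-(t ^ 2 / 2 * (a ^ 2 + 2 * d ^ 2)) : ℝ)‖ ≤
      8 * |t| ^ 3 * |d| * (a ^ 2 + 2 * d ^ 2) := by
  set z : ℂ := 2 * t * d * I with hz
  have hnz : ‖z‖ = |2 * t * d| := by
    rw [hz, norm_mul, norm_I, mul_one]
    exact_mod_cast Complex.norm_real (2 * t * d)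
  have hz2 : z ^ 2 = -(4 * t ^ 2 * d ^ 2) := by rw [hz, mul_pow, I_sq]; ring
  have hzre : (1 - z).re = 1 := by simp [hz]
  have hz0 : 1 - z ≠ 0 := fun h => by simp [h] at hzre
  have hz1 : 1 ≤ ‖1 - z‖ := by
    have := Complex.abs_re_le_norm (1 - z)
    rwa [hzre, abs_one] at this
  have hlog : ‖log (1 - z) + z + z ^ 2 / 2‖ ≤ ‖z‖ ^ 3 := by
    have h1 := norm_log_sub_logTaylor_le 2 (z := -z) (by rw [norm_neg, hnz]; linarith)
    have h2 : logTaylor (2 + 1) (-z) = -z - z ^ 2 / 2 := by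
      simp [logTaylor_succ, logTaylor_zero]
      ring
    rw [h2, norm_neg] at h1
    have h3 : log (1 + -z) - (-z - z ^ 2 / 2) = log (1 - z) + z + z ^ 2 / 2 := by
      rw [← sub_eq_add_neg]; ring
    rw [h3] at h1
    refine h1.trans ?_
    have h4 : (1 - ‖z‖)⁻¹ ≤ 2 := by
      rw [inv_le_comm₀ (by linarith) (by norm_num)]
      linarith
    have h5 : 0 ≤ ‖z‖ ^ 3 := by positivity
    rw [div_le_iff₀ (by positivity)]
    norm_num
    nlinarith
  have hkey : (-(log (1 - z) + z) / 2 - t ^ 2 * a ^ 2 / (2 * (1 - z))) -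
      (-(t ^ 2 / 2 * (a ^ 2 + 2 * d ^ 2)) : ℝ) =
      -(log (1 - z) + z + z ^ 2 / 2) / 2 - (t ^ 2 * a ^ 2 / 2 : ℝ) * (z / (1 - z)) := by
    rw [hz2]
    push_cast
    field_simp
    ring
  rw [hkey]
  have hb : ‖(t ^ 2 * a ^ 2 / 2 : ℝ) * (z / (1 - z))‖ ≤ t ^ 2 * a ^ 2 / 2 * ‖z‖ := by
    rw [norm_mul, Complex.norm_real, Real.norm_of_nonneg (by positivity), norm_div]
    gcongr
    exact div_le_self (norm_nonneg _) hz1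
  have ha : ‖-(log (1 - z) + z + z ^ 2 / 2) / 2‖ ≤ ‖z‖ ^ 3 / 2 := by
    rw [norm_div, norm_neg, Complex.norm_ofNat]
    gcongr
  refine (norm_sub_le _ _).trans ((add_le_add ha hb).trans ?_)
  rw [hnz, abs_mul, abs_mul, abs_two, mul_pow, mul_pow, ← sq_abs t, ← sq_abs a, ← sq_abs d]
  have e1 : 0 ≤ |t| ^ 3 * |d| * |a| ^ 2 := by positivity
  have e2 : 0 ≤ |t| ^ 3 * |d| ^ 3 := by positivity
  nlinarith

open Complex in
/-- Central limit theorem for triangular arrays `∑ⱼ (aⱼ gⱼ + dⱼ (gⱼ² - 1))` of quadratic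
polynomials in independent standard Gaussian variables, at the level of characteristic functions.
The linear coefficients `aⱼ` need not be small, since the linear part is exactly Gaussian. -/
lemma tendsto_prod_charFun_quadratic {ι : ℕ → Type*} [∀ n, Fintype (ι n)]
    (a d : (n : ℕ) → ι n → ℝ) (m : ℕ → ℝ) (hm : Tendsto m atTop (𝓝 0))
    (hd : ∀ᶠ n in atTop, ∀ j, |d n j| ≤ m n) (s : ℝ)
    (hs : Tendsto (fun n => ∑ j, (a n j ^ 2 + 2 * d n j ^ 2)) atTop (𝓝 s)) (t : ℝ) :
    Tendsto (fun n => ∏ j, ∫ x, cexp ((t * (a n j * x + d n j * (x ^ 2 - 1)) : ℝ) * I)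
      ∂(gaussianReal 0 1)) atTop (𝓝 (cexp (-(t ^ 2 / 2 * s) : ℝ))) := by
  simp_rw [integral_cexp_quadratic_gaussianReal, ← Complex.exp_sum]
  refine (Complex.continuous_exp.tendsto _).comp ?_
  have hmain : Tendsto (fun n => ((-(t ^ 2 / 2 * ∑ j, (a n j ^ 2 + 2 * d n j ^ 2)) : ℝ) : ℂ)) atTop
      (𝓝 ((-(t ^ 2 / 2 * s) : ℝ) : ℂ)) :=
    (Complex.continuous_ofReal.tendsto _).comp ((hs.const_mul _).neg)
  refine (tendsto_iff_of_dist ?_).1 hmain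
  have hbound : Tendsto (fun n => 8 * |t| ^ 3 * m n * ∑ j, (a n j ^ 2 + 2 * d n j ^ 2)) atTop
      (𝓝 0) := by
    simpa using (hm.const_mul (8 * |t| ^ 3)).mul hs
  have hsmall : ∀ᶠ n in atTop, |2 * t| * m n ≤ 1 / 2 := by
    have h0 : Tendsto (fun n => |2 * t| * m n) atTop (𝓝 0) := by simpa using hm.const_mul |2 * t|
    exact h0.eventually (eventually_le_nhds (by norm_num))
  refine squeeze_zero' (Eventually.of_forall fun n => dist_nonneg) ?_ hbound
  filter_upwards [hsmall, hd] with n hn hdn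
  rw [dist_comm, dist_eq_norm, Finset.mul_sum, ← Finset.sum_neg_distrib, Complex.ofReal_sum,
    ← Finset.sum_sub_distrib, Finset.mul_sum]
  refine (norm_sum_le _ _).trans (Finset.sum_le_sum fun j _ => ?_)
  have h1 : |2 * t * d n j| ≤ 1 / 2 := by
    rw [abs_mul]
    exact (mul_le_mul_of_nonneg_left (hdn j) (abs_nonneg _)).trans hn
  refine (norm_quadratic_exponent_sub_le h1).trans ?_
  gcongr
  exact hdn j

/-! ### Spectral representation of a centred Gaussian vector -/
open Complex in
lemma charFun_pi_sum {ι E : Type*} [Fintype ι] [NormedAddCommGroup E] [InnerProductSpace ℝ E]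
    [MeasurableSpace E] [BorelSpace E] [SecondCountableTopology E] (v : ι → E) (t : E) :
    charFun ((Measure.pi fun _ : ι => gaussianReal 0 1).map (fun g => ∑ j, g j • v j)) t =
      cexp (-(∑ j, (inner ℝ (v j) t) ^ 2 : ℝ) / 2) := by
  rw [charFun_apply, integral_map (Measurable.aemeasurable (by fun_prop))
    (Measurable.aestronglyMeasurable (by fun_prop))]
  simp_rw [sum_inner, ofReal_sum, Finset.sum_mul, exp_sum,
    integral_fintype_prod_eq_prod (f := fun i (x : ℝ) ↦ cexp ((inner ℝ (x • v i) t : ℝ) * I)),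
    real_inner_smul_left, mul_comm _ (inner ℝ _ _), ofReal_mul, ← charFun_apply_real,
    charFun_gaussianReal]
  simp only [ofReal_zero, mul_zero, zero_mul, NNReal.coe_one, ofReal_one, one_mul, zero_sub]
  simp_rw [← exp_sum, Finset.sum_neg_distrib, ← Finset.sum_div, ← ofReal_pow, neg_div]

/-- A positive semidefinite matrix `S` comes with an orthonormal basis of eigenvectors `vⱼ` and
eigenvalues `λⱼ ≥ 0`, and `N(0, S)` is the law of `∑ⱼ √λⱼ gⱼ vⱼ` for independent standard
Gaussian `gⱼ`. -/
lemma exists_spectral_gaussian {ι : Type*} [Fintype ι] [DecidableEq ι] {S : Matrix ι ι ℝ}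
    (hS : S.PosSemidef) :
    ∃ (lam : ι → ℝ) (v : OrthonormalBasis ι ℝ (EuclideanSpace ℝ ι)),
      (∀ j, 0 ≤ lam j) ∧ ∑ j, lam j = S.trace ∧ ∑ j, lam j ^ 2 = (S * S).trace ∧
      (∀ t : EuclideanSpace ℝ ι, ∑ j, lam j * inner ℝ (v j) t ^ 2 = t ⬝ᵥ S *ᵥ t) ∧
      multivariateGaussian 0 S = (Measure.pi fun _ : ι => gaussianReal 0 1).map
        (fun g => ∑ j, g j • (√(lam j) • v j)) := by
  have hH := hS.isHermitian
  have hquad (t : EuclideanSpace ℝ ι) :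
      ∑ j, hH.eigenvalues j * inner ℝ (hH.eigenvectorBasis j) t ^ 2 = t ⬝ᵥ S *ᵥ t := by
    have h1 : t ⬝ᵥ S *ᵥ t = inner ℝ t (WithLp.toLp 2 (S *ᵥ t.ofLp)) := by
      simp [PiLp.inner_apply, dotProduct, mul_comm]
    rw [h1, ← hH.eigenvectorBasis.sum_inner_mul_inner]
    refine Finset.sum_congr rfl fun j _ => ?_
    have h2 : inner ℝ (hH.eigenvectorBasis j) (WithLp.toLp 2 (S *ᵥ t.ofLp)) =
        hH.eigenvalues j * inner ℝ (hH.eigenvectorBasis j) t := by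
      have h3 : inner ℝ (hH.eigenvectorBasis j) (WithLp.toLp 2 (S *ᵥ t.ofLp)) =
          (S *ᵥ t.ofLp) ⬝ᵥ (hH.eigenvectorBasis j).ofLp := by
        simp [PiLp.inner_apply, dotProduct]
      have h4 : inner ℝ (hH.eigenvectorBasis j) t = t.ofLp ⬝ᵥ (hH.eigenvectorBasis j).ofLp := by
        simp [PiLp.inner_apply, dotProduct]
      have hsymm : Sᵀ = S := hH
      rw [h3, h4, dotProduct_comm, Matrix.dotProduct_mulVec, ← Matrix.mulVec_transpose, hsymm,
        hH.mulVec_eigenvectorBasis, smul_dotProduct, smul_eq_mul, dotProduct_comm]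
    rw [h2, real_inner_comm]
    ring
  refine ⟨hH.eigenvalues, hH.eigenvectorBasis, hS.eigenvalues_nonneg, ?_, ?_, hquad, ?_⟩
  · simpa using hH.trace_eq_sum_eigenvalues.symm
  · have h := hH.spectral_theorem
    set D := Matrix.diagonal (RCLike.ofReal (K := ℝ) ∘ hH.eigenvalues) with hD
    have h2 : (S * S).trace = (D * D).trace := by
      conv_lhs => rw [h, ← map_mul]
      rw [Unitary.conjStarAlgAut_apply, Matrix.trace_mul_comm, ← mul_assoc]
      simp
    rw [h2, hD, Matrix.diagonal_mul_diagonal, Matrix.trace_diagonal]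
    simp [sq]
  · apply Measure.ext_of_charFun
    ext t
    rw [charFun_multivariateGaussian hS, charFun_pi_sum, inner_zero_right, ← hquad]
    congr 1
    simp only [inner_smul_left, mul_pow]
    simp [Real.sq_sqrt (hS.eigenvalues_nonneg _), neg_div]

/-! ### Regression residuals of the design on the response -/

open Complex in
lemma charFun_multivariateGaussian_zero {ι : Type*} [Fintype ι] [DecidableEq ι] {S : Matrix ι ι ℝ}
    (hS : S.PosSemidef) (t : EuclideanSpace ℝ ι) :
    charFun (multivariateGaussian 0 S) t = cexp (-(t ⬝ᵥ S *ᵥ t : ℝ) / 2) := by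
  rw [charFun_multivariateGaussian hS, inner_zero_right]
  simp [neg_div]

/-- The covariance matrix of the residual of a Gaussian vector `x ∼ N(0, A)` after regression on
the scalar `β · x + e`, where `e` is an independent error of variance `σ²`. -/
noncomputable def residualCov {ι : Type*} [Fintype ι] (A : Matrix ι ι ℝ) (β : ι → ℝ) (σ : ℝ) :
    Matrix ι ι ℝ :=
  A - (β ⬝ᵥ A *ᵥ β + σ ^ 2)⁻¹ • Matrix.vecMulVec (A *ᵥ β) (A *ᵥ β)

lemma dotProduct_residualCov_mulVec {ι : Type*} [Fintype ι] (A : Matrix ι ι ℝ) (β : ι → ℝ) (σ : ℝ)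
    (x : ι → ℝ) :
    x ⬝ᵥ residualCov A β σ *ᵥ x =
      x ⬝ᵥ A *ᵥ x - (β ⬝ᵥ A *ᵥ β + σ ^ 2)⁻¹ * (x ⬝ᵥ A *ᵥ β) ^ 2 := by
  rw [residualCov, Matrix.sub_mulVec, Matrix.smul_mulVec, Matrix.vecMulVec_mulVec,
    dotProduct_sub, dotProduct_smul, dotProduct_smul, dotProduct_comm (A *ᵥ β) x]
  simp only [smul_eq_mul, MulOpposite.smul_eq_mul_unop, MulOpposite.unop_op]
  ring

lemma dotProduct_mulVec_comm {ι : Type*} [Fintype ι] {A : Matrix ι ι ℝ} (hA : A.IsHermitian)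
    (x y : ι → ℝ) : x ⬝ᵥ A *ᵥ y = y ⬝ᵥ A *ᵥ x := by
  have hsymm : Aᵀ = A := hA
  rw [Matrix.dotProduct_mulVec, ← Matrix.mulVec_transpose, hsymm, dotProduct_comm]

lemma residualCov_posSemidef {ι : Type*} [Fintype ι] {A : Matrix ι ι ℝ}
    (hA : A.PosSemidef) (β : ι → ℝ) {σ : ℝ} (hσ : 0 < σ) : (residualCov A β σ).PosSemidef := by
  have hq (x : ι → ℝ) : 0 ≤ x ⬝ᵥ A *ᵥ x := by simpa using hA.dotProduct_mulVec_nonneg x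
  refine Matrix.PosSemidef.of_dotProduct_mulVec_nonneg ?_ fun x => ?_
  · refine hA.isHermitian.sub ?_
    ext i j
    simp [Matrix.vecMulVec_apply, mul_comm]
  · rw [star_trivial, dotProduct_residualCov_mulVec]
    set τ := β ⬝ᵥ A *ᵥ β + σ ^ 2 with hτ
    have hτ0 : 0 < τ := by have := hq β; positivity
    -- The value of the quadratic form of `A` at `x - (x · A β / τ) β`.
    have h := hq (x - (τ⁻¹ * (x ⬝ᵥ A *ᵥ β)) • β)
    have hexp : (x - (τ⁻¹ * (x ⬝ᵥ A *ᵥ β)) • β) ⬝ᵥ A *ᵥ (x - (τ⁻¹ * (x ⬝ᵥ A *ᵥ β)) • β) =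
        x ⬝ᵥ A *ᵥ x - 2 * τ⁻¹ * (x ⬝ᵥ A *ᵥ β) ^ 2 +
          τ⁻¹ ^ 2 * (x ⬝ᵥ A *ᵥ β) ^ 2 * (β ⬝ᵥ A *ᵥ β) := by
      rw [Matrix.mulVec_sub, Matrix.mulVec_smul]
      simp only [sub_dotProduct, dotProduct_sub, smul_dotProduct, dotProduct_smul, smul_eq_mul,
        dotProduct_mulVec_comm hA.isHermitian β x]
      ring
    have hβ : β ⬝ᵥ A *ᵥ β = τ - σ ^ 2 := by rw [hτ]; ring
    rw [hexp, hβ] at h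
    have h2 : τ⁻¹ ^ 2 * (x ⬝ᵥ A *ᵥ β) ^ 2 * (τ - σ ^ 2) =
        τ⁻¹ * (x ⬝ᵥ A *ᵥ β) ^ 2 - τ⁻¹ ^ 2 * (x ⬝ᵥ A *ᵥ β) ^ 2 * σ ^ 2 := by
      field_simp
    have h3 : 0 ≤ τ⁻¹ ^ 2 * (x ⬝ᵥ A *ᵥ β) ^ 2 * σ ^ 2 := by positivity
    linarith

/-- The residual of a row of the design regressed on the response, paired with the response. -/
noncomputable def residualPair {ι : Type*} [Fintype ι] (A : Matrix ι ι ℝ) (β : ι → ℝ) (σ : ℝ)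
    (z : EuclideanSpace ℝ ι × ℝ) : EuclideanSpace ℝ ι × ℝ :=
  (z.1 - ((β ⬝ᵥ A *ᵥ β + σ ^ 2)⁻¹ * (inner ℝ (WithLp.toLp 2 β) z.1 + z.2)) •
      WithLp.toLp 2 (A *ᵥ β),
    inner ℝ (WithLp.toLp 2 β) z.1 + z.2)

@[fun_prop]
lemma measurable_residualPair {ι : Type*} [Fintype ι] (A : Matrix ι ι ℝ) (β : ι → ℝ) (σ : ℝ) :
    Measurable (residualPair A β σ) := by
  unfold residualPair
  fun_prop

open Complex in
/-- The residual and the response are independent Gaussian: their joint characteristic function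
factors because the quadratic form of `A` splits along the regression. -/
lemma map_residualPair {ι : Type*} [Fintype ι] [DecidableEq ι] {A : Matrix ι ι ℝ}
    (hA : A.PosSemidef) (β : ι → ℝ) {σ : ℝ} (hσ : 0 < σ) :
    ((multivariateGaussian 0 A).prod (gaussianReal 0 (σ ^ 2).toNNReal)).map (residualPair A β σ) =
      (multivariateGaussian 0 (residualCov A β σ)).prod
        (gaussianReal 0 (β ⬝ᵥ A *ᵥ β + σ ^ 2).toNNReal) := by
  have hτ0 : 0 < β ⬝ᵥ A *ᵥ β + σ ^ 2 := by
    have : 0 ≤ β ⬝ᵥ A *ᵥ β := by simpa using hA.dotProduct_mulVec_nonneg β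
    positivity
  have : IsFiniteMeasure (((multivariateGaussian 0 A).prod
      (gaussianReal 0 (σ ^ 2).toNNReal)).map (residualPair A β σ)) :=
    Measure.isFiniteMeasure_map _ _
  rw [← charFun_eq_prod_iff]
  intro t
  set u := (WithLp.ofLp t).1 with hu
  set s := (WithLp.ofLp t).2 with hs
  rw [Measure.map_map (by fun_prop) (by fun_prop), charFun_apply,
    integral_map (Measurable.aemeasurable (by fun_prop))
      (Measurable.aestronglyMeasurable (by fun_prop))]
  set τ := β ⬝ᵥ A *ᵥ β + σ ^ 2 with hτ
  set b : EuclideanSpace ℝ ι := WithLp.toLp 2 (A *ᵥ β) with hb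
  set w := s - τ⁻¹ * inner ℝ b u with hw
  set β' : EuclideanSpace ℝ ι := WithLp.toLp 2 β with hβ'
  have h1 (z : EuclideanSpace ℝ ι × ℝ) :
      cexp ((inner ℝ ((WithLp.toLp 2 ∘ residualPair A β σ) z) t : ℝ) * I) =
        cexp ((inner ℝ z.1 (u + w • β') : ℝ) * I) * cexp ((w * z.2 : ℝ) * I) := by
    rw [← Complex.exp_add, ← add_mul, ← ofReal_add]
    congr 3
    rw [WithLp.prod_inner_apply]
    simp only [Function.comp, residualPair, ← hu, ← hs, ← hτ, ← hb, ← hβ', inner_sub_left,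
      inner_add_right, inner_smul_left, inner_smul_right, real_inner_comm z.1 β', hw]
    simp
    ring
  simp_rw [h1]
  rw [integral_prod_mul (fun x : EuclideanSpace ℝ ι => cexp ((inner ℝ x (u + w • β') : ℝ) * I))
    (fun y : ℝ => cexp ((w * y : ℝ) * I))]
  simp_rw [ofReal_mul]
  rw [← charFun_apply, ← charFun_apply_real, charFun_multivariateGaussian_zero hA,
    charFun_multivariateGaussian_zero (residualCov_posSemidef hA β hσ), charFun_gaussianReal,
    charFun_gaussianReal, ← Complex.exp_add, ← Complex.exp_add]
  congr 1
  have hub : inner ℝ b u = u.ofLp ⬝ᵥ A *ᵥ β := by simp [PiLp.inner_apply, dotProduct, hb]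
  have hquad : (u + w • β').ofLp ⬝ᵥ A *ᵥ (u + w • β').ofLp + σ ^ 2 * w ^ 2 =
      u.ofLp ⬝ᵥ residualCov A β σ *ᵥ u.ofLp + τ * s ^ 2 := by
    rw [dotProduct_residualCov_mulVec, ← hτ]
    simp only [WithLp.ofLp_add, WithLp.ofLp_smul, hβ', Matrix.mulVec_add, Matrix.mulVec_smul,
      add_dotProduct, dotProduct_add, smul_dotProduct, dotProduct_smul, smul_eq_mul,
      dotProduct_mulVec_comm hA.isHermitian β u.ofLp]
    have hβτ : β ⬝ᵥ A *ᵥ β = τ - σ ^ 2 := by rw [hτ]; ring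
    rw [hβτ, hw, hub]
    field_simp
    ring
  rw [Real.coe_toNNReal _ (sq_nonneg σ), Real.coe_toNNReal _ hτ0.le]
  have hquad' : ((((u + w • β').ofLp ⬝ᵥ A *ᵥ (u + w • β').ofLp : ℝ) : ℂ)) + σ ^ 2 * w ^ 2 =
      (u.ofLp ⬝ᵥ residualCov A β σ *ᵥ u.ofLp : ℝ) + τ * s ^ 2 := by exact_mod_cast hquad
  simp only [ofReal_zero, mul_zero, zero_mul, zero_sub]
  push_cast
  linear_combination (-1 / 2 : ℂ) * hquad'

/-! ### The law of `‖X'Y‖²` -/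

open Complex in
/-- Integrating out a Gaussian vector that enters linearly. -/
lemma integral_cexp_inner_multivariateGaussian_prod {ι α : Type*} [Fintype ι] [DecidableEq ι]
    {S : Matrix ι ι ℝ} (hS : S.PosSemidef) {mα : MeasurableSpace α} (ν : Measure α)
    [IsProbabilityMeasure ν] {f g : α → ℝ} (hf : Measurable f) (hg : Measurable g)
    (u : EuclideanSpace ℝ ι) :
    ∫ z, cexp ((f z.2 * inner ℝ z.1 u + g z.2 : ℝ) * I) ∂((multivariateGaussian 0 S).prod ν) =
      ∫ y, cexp (-(f y ^ 2 * (u ⬝ᵥ S *ᵥ u) : ℝ) / 2 + g y * I) ∂ν := by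
  rw [integral_prod_symm]
  · refine integral_congr_ae (Eventually.of_forall fun y => ?_)
    have h1 (x : EuclideanSpace ℝ ι) : cexp ((f y * inner ℝ x u + g y : ℝ) * I) =
        cexp ((inner ℝ x (f y • u) : ℝ) * I) * cexp (g y * I) := by
      rw [← Complex.exp_add, inner_smul_right]
      push_cast
      ring_nf
    simp only [h1]
    rw [integral_mul_const, ← charFun_apply, charFun_multivariateGaussian_zero hS,
      ← Complex.exp_add]
    congr 3
    simp only [WithLp.ofLp_smul, Matrix.mulVec_smul, smul_dotProduct, dotProduct_smul, smul_eq_mul]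
    push_cast
    ring
  · refine Integrable.of_bound (Measurable.aestronglyMeasurable (by fun_prop)) 1
      (Eventually.of_forall fun z => ?_)
    rw [Complex.norm_exp_ofReal_mul_I]

open Complex in
/-- Given the responses `yᵢ`, the sum `∑ᵢ yᵢ rᵢ` of independent `N(0, S)` residuals has the law of
`‖y‖ u` with a single `u ∼ N(0, S)`. -/
lemma map_sum_smul_pair {ι κ : Type*} [Fintype ι] [DecidableEq ι] [Fintype κ]
    {S : Matrix ι ι ℝ} (hS : S.PosSemidef) (ν : Measure ℝ) [IsProbabilityMeasure ν] :
    (Measure.pi fun _ : κ => (multivariateGaussian 0 S).prod ν).map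
        (fun z => (∑ i, (z i).2 • (z i).1, WithLp.toLp 2 fun i => (z i).2)) =
      ((multivariateGaussian 0 S).prod (Measure.pi fun _ : κ => ν)).map
        (fun z => (‖WithLp.toLp 2 z.2‖ • z.1, WithLp.toLp 2 z.2)) := by
  refine (MeasurableEquiv.toLp 2
    (EuclideanSpace ℝ ι × EuclideanSpace ℝ κ)).map_measurableEquiv_injective ?_
  rw [MeasurableEquiv.coe_toLp, Measure.map_map (by fun_prop) (by fun_prop),
    Measure.map_map (by fun_prop) (by fun_prop)]
  have := Measure.isProbabilityMeasure_map
    (μ := Measure.pi fun _ : κ => (multivariateGaussian 0 S).prod ν)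
    (f := WithLp.toLp 2 ∘ fun z => (∑ i, (z i).2 • (z i).1, WithLp.toLp 2 fun i => (z i).2))
    (Measurable.aemeasurable (by fun_prop))
  have := Measure.isProbabilityMeasure_map
    (μ := (multivariateGaussian 0 S).prod (Measure.pi fun _ : κ => ν))
    (f := WithLp.toLp 2 ∘ fun z => (‖WithLp.toLp 2 z.2‖ • z.1, WithLp.toLp 2 z.2))
    (Measurable.aemeasurable (by fun_prop))
  refine Measure.ext_of_charFun (funext fun t => ?_)
  set u := (WithLp.ofLp t).1 with hu
  set s := (WithLp.ofLp t).2 with hs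
  rw [charFun_apply, charFun_apply, integral_map (Measurable.aemeasurable (by fun_prop))
    (Measurable.aestronglyMeasurable (by fun_prop)),
    integral_map (Measurable.aemeasurable (by fun_prop))
    (Measurable.aestronglyMeasurable (by fun_prop))]
  have hinner (y : κ → ℝ) : inner ℝ (WithLp.toLp 2 y) s = ∑ i, y i * s i := by
    simp [PiLp.inner_apply, mul_comm]
  have hl (z : κ → EuclideanSpace ℝ ι × ℝ) :
      cexp ((inner ℝ ((WithLp.toLp 2 ∘ fun z : κ → EuclideanSpace ℝ ι × ℝ =>
        (∑ i, (z i).2 • (z i).1, WithLp.toLp 2 fun i => (z i).2)) z) t : ℝ) * I) =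
      ∏ i, cexp (((z i).2 * inner ℝ (z i).1 u + (z i).2 * s i : ℝ) * I) := by
    rw [← Complex.exp_sum, ← Finset.sum_mul, ← ofReal_sum, WithLp.prod_inner_apply,
      Finset.sum_add_distrib, ← hinner]
    simp only [Function.comp, ← hu, ← hs, sum_inner, inner_smul_left, RCLike.conj_to_real]
  have hr (z : EuclideanSpace ℝ ι × (κ → ℝ)) :
      cexp ((inner ℝ ((WithLp.toLp 2 ∘ fun z : EuclideanSpace ℝ ι × (κ → ℝ) =>
        (‖WithLp.toLp 2 z.2‖ • z.1, WithLp.toLp 2 z.2)) z) t : ℝ) * I) =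
      cexp ((‖WithLp.toLp 2 z.2‖ * inner ℝ z.1 u + ∑ i, z.2 i * s i : ℝ) * I) := by
    rw [WithLp.prod_inner_apply, ← hinner]
    simp only [Function.comp, ← hu, ← hs, inner_smul_left, RCLike.conj_to_real]
  simp_rw [hl, hr]
  rw [integral_fintype_prod_eq_prod (f := fun i (x : EuclideanSpace ℝ ι × ℝ) =>
      cexp ((x.2 * inner ℝ x.1 u + x.2 * s i : ℝ) * I)),
    integral_cexp_inner_multivariateGaussian_prod hS (Measure.pi fun _ : κ => ν)
      (f := fun y => ‖WithLp.toLp 2 y‖) (g := fun y => ∑ i, y i * s i) (by fun_prop) (by fun_prop)]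
  simp_rw [fun i => integral_cexp_inner_multivariateGaussian_prod hS ν
    (f := fun y => y) (g := fun y => y * s i) (by fun_prop) (by fun_prop) u]
  rw [← integral_fintype_prod_eq_prod (f := fun i (y : ℝ) =>
    cexp (-(y ^ 2 * (u ⬝ᵥ S *ᵥ u) : ℝ) / 2 + (y * s i : ℝ) * I))]
  refine integral_congr_ae (Eventually.of_forall fun y => ?_)
  simp only
  rw [← Complex.exp_sum, EuclideanSpace.real_norm_sq_eq, Finset.sum_add_distrib,
    ← Finset.sum_mul, ← ofReal_sum, ← Finset.sum_div, Finset.sum_neg_distrib, ← ofReal_sum,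
    Finset.sum_mul]

lemma hasLaw_pi_of_multivariateGaussian {Ω : Type*} [MeasurableSpace Ω] {P : Measure Ω}
    [IsProbabilityMeasure P] {n : ℕ} {σ : ℝ} {ε : Ω → Fin n → ℝ}
    (h : HasLaw (fun ω => WithLp.toLp 2 (ε ω))
      (multivariateGaussian (0 : EuclideanSpace ℝ (Fin n))
        (σ ^ 2 • (1 : Matrix (Fin n) (Fin n) ℝ))) P) :
    HasLaw ε (Measure.pi fun _ : Fin n => gaussianReal 0 (σ ^ 2).toNNReal) P := by
  have hε : AEMeasurable ε P := by
    have := (show Measurable (WithLp.ofLp : EuclideanSpace ℝ (Fin n) → _) by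
      fun_prop).comp_aemeasurable h.aemeasurable
    exact this
  refine ⟨hε, ?_⟩
  have := Measure.isProbabilityMeasure_map hε
  have hS : (σ ^ 2 • (1 : Matrix (Fin n) (Fin n) ℝ)).PosSemidef :=
    Matrix.PosSemidef.one.smul (sq_nonneg σ)
  rw [← charFun_eq_pi_iff]
  intro t
  rw [AEMeasurable.map_map_of_aemeasurable (by fun_prop) hε]
  have h2 : P.map (WithLp.toLp 2 ∘ ε) = _ := h.map_eq
  rw [h2, charFun_multivariateGaussian_zero hS]
  simp_rw [charFun_gaussianReal]
  rw [← Complex.exp_sum, Real.coe_toNNReal _ (sq_nonneg σ)]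
  congr 1
  have h3 : t.ofLp ⬝ᵥ (σ ^ 2 • (1 : Matrix (Fin n) (Fin n) ℝ)) *ᵥ t.ofLp =
      ∑ i, σ ^ 2 * t i ^ 2 := by
    rw [Matrix.smul_mulVec, Matrix.one_mulVec, dotProduct]
    exact Finset.sum_congr rfl fun i _ => by simp only [Pi.smul_apply, smul_eq_mul]; ring
  rw [h3]
  push_cast
  simp only [mul_zero, zero_mul, zero_sub, Finset.sum_neg_distrib, ← Finset.sum_div, neg_div]

lemma IsKMSRegression.hasLaw_pairs {Ω : Type*} [MeasurableSpace Ω] {P : Measure Ω}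
    [IsProbabilityMeasure P] {n p : ℕ} {ρ σ : ℝ} {β : Fin p → ℝ} {X : Ω → Fin n → Fin p → ℝ}
    {ε Y : Ω → Fin n → ℝ} (h : IsKMSRegression P ρ σ β X ε Y) :
    HasLaw (fun ω i => (WithLp.toLp 2 (X ω i), ε ω i))
      (Measure.pi fun _ : Fin n => (multivariateGaussian (0 : EuclideanSpace ℝ (Fin p))
        (kmsMatrix ρ p)).prod (gaussianReal 0 (σ ^ 2).toNNReal)) P := by
  have hX : HasLaw (fun ω i => WithLp.toLp 2 (X ω i)) (Measure.pi fun _ : Fin n =>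
      multivariateGaussian (0 : EuclideanSpace ℝ (Fin p)) (kmsMatrix ρ p)) P :=
    iIndepFun.hasLaw_pi h.rows_law
      (h.rows_indep.comp (fun _ => WithLp.toLp 2) fun _ => by fun_prop)
  have hε := hasLaw_pi_of_multivariateGaussian h.errors_law
  have hind : IndepFun (fun ω i => WithLp.toLp 2 (X ω i)) ε P :=
    h.design_indep_errors.comp
      (φ := fun x : Fin n → Fin p → ℝ => fun i => (WithLp.toLp 2 (x i) : EuclideanSpace ℝ (Fin p)))
      (ψ := id) (by fun_prop) measurable_id
  have hprod := hind.hasLaw_prod hX hε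
  have hmp := (measurePreserving_arrowProdEquivProdArrow (EuclideanSpace ℝ (Fin p)) ℝ (Fin n)
    (fun _ => multivariateGaussian 0 (kmsMatrix ρ p))
    (fun _ => gaussianReal 0 (σ ^ 2).toNNReal)).symm
  exact HasLaw.comp ⟨hmp.measurable.aemeasurable, hmp.map_eq⟩ hprod

/-- The statistic `‖X'Y‖²` in terms of the responses and the residuals. -/
lemma sqNormXtY_eq_residual {n p : ℕ} (A : Matrix (Fin p) (Fin p) ℝ) (β : Fin p → ℝ) (σ : ℝ)
    (X : Fin n → Fin p → ℝ) (e : Fin n → ℝ) :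
    sqNormXtY X (Matrix.of X *ᵥ β + e) =
      ‖(∑ i, (residualPair A β σ (WithLp.toLp 2 (X i), e i)).2 •
          (residualPair A β σ (WithLp.toLp 2 (X i), e i)).1) +
        ((β ⬝ᵥ A *ᵥ β + σ ^ 2)⁻¹ *
          ‖WithLp.toLp 2 fun i => (residualPair A β σ (WithLp.toLp 2 (X i), e i)).2‖ ^ 2) •
          WithLp.toLp 2 (A *ᵥ β)‖ ^ 2 := by
  set y := Matrix.of X *ᵥ β + e with hy
  have hpair (i : Fin n) : residualPair A β σ (WithLp.toLp 2 (X i), e i) =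
      (WithLp.toLp 2 (X i) - ((β ⬝ᵥ A *ᵥ β + σ ^ 2)⁻¹ * y i) • WithLp.toLp 2 (A *ᵥ β), y i) := by
    have : inner ℝ (WithLp.toLp 2 β) (WithLp.toLp 2 (X i)) + e i = y i := by
      simp [hy, PiLp.inner_apply, Matrix.mulVec, dotProduct]
    simp only [residualPair, this]
  simp_rw [hpair]
  rw [sqNormXtY]
  congr 2
  have h1 : WithLp.toLp 2 ((Matrix.of X)ᵀ *ᵥ y) = ∑ i, y i • WithLp.toLp 2 (X i) := by
    ext j
    simp [Matrix.mulVec, dotProduct, mul_comm]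
  rw [h1, EuclideanSpace.real_norm_sq_eq]
  simp only [smul_sub, smul_smul, Finset.sum_sub_distrib, ← Finset.sum_smul]
  rw [show ∑ i, y i * ((β ⬝ᵥ A *ᵥ β + σ ^ 2)⁻¹ * y i) = (β ⬝ᵥ A *ᵥ β + σ ^ 2)⁻¹ * ∑ i, y i ^ 2 by
    rw [Finset.mul_sum]; exact Finset.sum_congr rfl fun i _ => by ring]
  simp

/-- The random variable whose law is that of `‖X'Y‖²`, in terms of independent standard Gaussian
`gⱼ` and `hᵢ`: with `q = ∑ᵢ hᵢ²`, it is
`τ² q ∑ⱼ λⱼ gⱼ² + 2 τ q ^ (3 / 2) ∑ⱼ aⱼ gⱼ + κ₂ q²`. -/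
noncomputable def quadStat {ι κ : Type*} [Fintype ι] [Fintype κ] (τ κ₂ : ℝ) (a lam : ι → ℝ)
    (z : (ι → ℝ) × (κ → ℝ)) : ℝ :=
  τ ^ 2 * (∑ i, z.2 i ^ 2) * (∑ j, lam j * z.1 j ^ 2) +
    2 * τ * √(∑ i, z.2 i ^ 2) ^ 3 * (∑ j, a j * z.1 j) + κ₂ * (∑ i, z.2 i ^ 2) ^ 2

lemma pi_gaussianReal_eq_map {κ : Type*} [Fintype κ] {v : ℝ} (hv : 0 ≤ v) :
    (Measure.pi fun _ : κ => gaussianReal 0 v.toNNReal) =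
      (Measure.pi fun _ : κ => gaussianReal 0 1).map fun h i => √v * h i := by
  have h1 : gaussianReal 0 v.toNNReal = (gaussianReal 0 1).map (√v * ·) := by
    rw [gaussianReal_map_const_mul, mul_zero, mul_one]
    congr 1
    ext
    simp [Real.sq_sqrt hv, hv]
  rw [Measure.pi_map_pi (f := fun (_ : κ) (x : ℝ) => √v * x) (fun _ => by fun_prop), h1]

/-- The law of `‖X'Y‖²`. The vector `a` and the eigenvalues `lam` describe the residual covariance
matrix `S = Σ - τ⁻² Σβ (Σβ)'`: `lam` are its eigenvalues, and `∑ aⱼ² = (Σβ)' S (Σβ)`. -/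
lemma IsKMSRegression.exists_map_sqNormXtY_eq {Ω : Type*} [MeasurableSpace Ω] {P : Measure Ω}
    [IsProbabilityMeasure P] {n p : ℕ} {ρ σ : ℝ} {β : Fin p → ℝ} {X : Ω → Fin n → Fin p → ℝ}
    {ε Y : Ω → Fin n → ℝ} (h : IsKMSRegression P ρ σ β X ε Y) (hρ : |ρ| < 1) (hσ : 0 < σ) :
    AEMeasurable (fun ω => sqNormXtY (X ω) (Y ω)) P ∧
    ∃ a lam : Fin p → ℝ, (∀ j, 0 ≤ lam j) ∧ (∀ j, lam j ≤ 2 * (1 - |ρ|)⁻¹) ∧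
      ∑ j, lam j = (residualCov (kmsMatrix ρ p) β σ).trace ∧
      ∑ j, lam j ^ 2 =
        (residualCov (kmsMatrix ρ p) β σ * residualCov (kmsMatrix ρ p) β σ).trace ∧
      ∑ j, a j ^ 2 = (kmsMatrix ρ p *ᵥ β) ⬝ᵥ
        residualCov (kmsMatrix ρ p) β σ *ᵥ (kmsMatrix ρ p *ᵥ β) ∧
      P.map (fun ω => sqNormXtY (X ω) (Y ω)) =
        ((Measure.pi fun _ : Fin p => gaussianReal 0 1).prod
          (Measure.pi fun _ : Fin n => gaussianReal 0 1)).map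
          (quadStat (√(β ⬝ᵥ kmsMatrix ρ p *ᵥ β + σ ^ 2))
            ((kmsMatrix ρ p *ᵥ β) ⬝ᵥ (kmsMatrix ρ p *ᵥ β)) a lam) := by
  have hA := kmsMatrix_posSemidef hρ.le p
  set A := kmsMatrix ρ p with hAdef
  set S := residualCov A β σ with hSdef
  have hS : S.PosSemidef := residualCov_posSemidef hA β hσ
  set v := β ⬝ᵥ A *ᵥ β + σ ^ 2 with hv
  have hv0 : 0 < v := by
    have : 0 ≤ β ⬝ᵥ A *ᵥ β := by simpa using hA.dotProduct_mulVec_nonneg β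
    positivity
  set b : EuclideanSpace ℝ (Fin p) := WithLp.toLp 2 (A *ᵥ β) with hb
  -- The statistic as a function of the residual sum and the responses.
  set F : EuclideanSpace ℝ (Fin p) × EuclideanSpace ℝ (Fin n) → ℝ :=
    fun z => ‖z.1 + (v⁻¹ * ‖z.2‖ ^ 2) • b‖ ^ 2 with hF
  have hFm : Measurable F := by fun_prop
  have hmeas : Measurable fun z : Fin n → EuclideanSpace ℝ (Fin p) × ℝ =>
      (∑ i, (z i).2 • (z i).1, (WithLp.toLp 2 fun i => (z i).2 : EuclideanSpace ℝ (Fin n))) := by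
    fun_prop
  have hstat : (fun ω => sqNormXtY (X ω) (Y ω)) = fun ω =>
      (F ∘ fun z : Fin n → EuclideanSpace ℝ (Fin p) × ℝ =>
      (∑ i, (z i).2 • (z i).1, (WithLp.toLp 2 fun i => (z i).2 : EuclideanSpace ℝ (Fin n))))
        (fun i => residualPair A β σ (WithLp.toLp 2 (X ω i), ε ω i)) := by
    funext ω
    rw [h.model ω, sqNormXtY_eq_residual A β σ]
    rfl
  have hpairs := h.hasLaw_pairs
  have hres : HasLaw (fun ω i => residualPair A β σ (WithLp.toLp 2 (X ω i), ε ω i))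
      (Measure.pi fun _ : Fin n => (multivariateGaussian 0 S).prod (gaussianReal 0 v.toNNReal))
      P := by
    have h1 : HasLaw (fun (z : Fin n → EuclideanSpace ℝ (Fin p) × ℝ) i => residualPair A β σ (z i))
        (Measure.pi fun _ : Fin n => (multivariateGaussian 0 S).prod (gaussianReal 0 v.toNNReal))
        (Measure.pi fun _ : Fin n => (multivariateGaussian 0 A).prod
          (gaussianReal 0 (σ ^ 2).toNNReal)) := by
      refine ⟨Measurable.aemeasurable (by fun_prop), ?_⟩
      rw [← map_residualPair hA β hσ]
      have (i : Fin n) : SigmaFinite (((multivariateGaussian 0 A).prod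
          (gaussianReal 0 (σ ^ 2).toNNReal)).map (residualPair A β σ)) := by
        rw [map_residualPair hA β hσ]
        infer_instance
      exact Measure.pi_map_pi (fun i => by fun_prop)
    exact h1.comp hpairs
  refine ⟨?_, ?_⟩
  · rw [hstat]
    exact (hFm.comp hmeas).comp_aemeasurable hres.aemeasurable
  obtain ⟨lam, w, hlam0, hsum, hsum2, hquad, hlaw⟩ := exists_spectral_gaussian hS
  refine ⟨fun j => √(lam j) * inner ℝ (w j) b, lam, hlam0, fun j => ?_, hsum, hsum2, ?_, ?_⟩
  · have h1 := hquad (w j)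
    have h2 : ∑ i, lam i * inner ℝ (w i) (w j) ^ 2 = lam j := by
      simp [w.inner_eq_ite]
    rw [h2, hSdef, dotProduct_residualCov_mulVec] at h1
    have h3 := dotProduct_kmsMatrix_mulVec_le hρ (w j).ofLp
    have h4 : (w j).ofLp ⬝ᵥ (w j).ofLp = 1 := by
      have h6 := EuclideanSpace.real_norm_sq_eq (w j)
      rw [w.norm_eq_one, one_pow] at h6
      simp only [dotProduct, h6, sq]
    rw [h4, mul_one] at h3
    have h5 : 0 ≤ v⁻¹ * ((w j).ofLp ⬝ᵥ A *ᵥ β) ^ 2 := by positivity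
    linarith
  · have h1 := hquad b
    rw [hb] at h1
    rw [← h1]
    refine Finset.sum_congr rfl fun j _ => ?_
    rw [mul_pow, Real.sq_sqrt (hlam0 j)]
  · rw [hstat]
    have hcomp : P.map (fun ω => (F ∘ fun z : Fin n → EuclideanSpace ℝ (Fin p) × ℝ =>
        (∑ i, (z i).2 • (z i).1, (WithLp.toLp 2 fun i => (z i).2 : EuclideanSpace ℝ (Fin n))))
          (fun i => residualPair A β σ (WithLp.toLp 2 (X ω i), ε ω i))) =
        ((P.map (fun ω i => residualPair A β σ (WithLp.toLp 2 (X ω i), ε ω i))).map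
          (fun z : Fin n → EuclideanSpace ℝ (Fin p) × ℝ => (∑ i, (z i).2 • (z i).1,
            (WithLp.toLp 2 fun i => (z i).2 : EuclideanSpace ℝ (Fin n))))).map F := by
      rw [Measure.map_map hFm hmeas, AEMeasurable.map_map_of_aemeasurable
        (hFm.comp hmeas).aemeasurable hres.aemeasurable]
      rfl
    rw [hcomp, hres.map_eq, map_sum_smul_pair hS, hlaw, pi_gaussianReal_eq_map hv0.le,
      Measure.map_prod_map _ _ (by fun_prop) (by fun_prop),
      Measure.map_map (by fun_prop) (by fun_prop), Measure.map_map (by fun_prop) (by fun_prop)]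
    congr 1
    funext z
    obtain ⟨g, k⟩ := z
    have hq : ‖(WithLp.toLp 2 fun i => √v * k i : EuclideanSpace ℝ (Fin n))‖ =
        √v * √(∑ i, k i ^ 2) := by
      rw [← Real.sqrt_mul hv0.le, EuclideanSpace.norm_eq]
      congr 1
      simp [mul_pow, Finset.mul_sum, Real.sq_sqrt hv0.le]
    set q := ∑ i, k i ^ 2 with hqdef
    have hq0 : 0 ≤ q := Finset.sum_nonneg fun i _ => sq_nonneg _
    set U : EuclideanSpace ℝ (Fin p) := ∑ j, g j • (√(lam j) • w j) with hU
    have hU2 : ‖U‖ ^ 2 = ∑ j, lam j * g j ^ 2 := by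
      rw [← real_inner_self_eq_norm_sq, hU]
      simp_rw [smul_smul]
      rw [w.orthonormal.inner_sum]
      refine Finset.sum_congr rfl fun j _ => ?_
      simp only [RCLike.conj_to_real]
      linear_combination g j ^ 2 * Real.sq_sqrt (hlam0 j)
    have hUb : inner ℝ U b = ∑ j, √(lam j) * inner ℝ (w j) b * g j := by
      rw [hU, sum_inner]
      refine Finset.sum_congr rfl fun j _ => ?_
      simp only [inner_smul_left, RCLike.conj_to_real]
      ring
    have hb2 : ‖b‖ ^ 2 = (A *ᵥ β) ⬝ᵥ (A *ᵥ β) := by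
      rw [EuclideanSpace.real_norm_sq_eq]
      simp [hb, dotProduct, sq]
    simp only [Function.comp, Prod.map, hF, quadStat, ← hU, hq, ← hqdef]
    rw [norm_add_sq_real, norm_smul, norm_smul, inner_smul_left, inner_smul_right]
    simp only [RCLike.conj_to_real, Real.norm_eq_abs, sq_abs, mul_pow, Real.sq_sqrt hv0.le,
      Real.sq_sqrt hq0, hU2, hb2, hUb]
    have hvv : v⁻¹ * v = 1 := inv_mul_cancel₀ hv0.ne'
    have hs3 : √q ^ 3 = q * √q := by rw [pow_succ, Real.sq_sqrt hq0]
    rw [hs3, ← mul_assoc v⁻¹ v q, hvv]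
    field_simp

/-! ### Linearization of the statistic -/

/-- The statistic minus its linearization, after normalization. Here `N = √n`, the sum of squares
of the responses is `τ² (N² + N D)`, the squared norm of the residual is `T + N Q`, its inner
product with `Σβ` is `L`, and `r = √(N² + N D)`. -/
lemma abs_normalized_sub_linear_le {N τ κ₂ p T D Q L r : ℝ} (hN : 1 ≤ N) (hτ : 0 < τ)
    (hκ : 0 ≤ κ₂) (hr : 0 ≤ r) (hr2 : r ^ 2 = N ^ 2 + N * D) (hT : τ ^ 2 * T = τ ^ 2 * p - κ₂) :
    |(τ ^ 2 * (N ^ 2 + N * D) * (T + N * Q) + 2 * τ * r ^ 3 * L + κ₂ * (N ^ 2 + N * D) ^ 2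
        - (N ^ 2) ^ 2 * κ₂ - p * N ^ 2 * τ ^ 2) / N ^ 3 -
      ((2 * κ₂ + τ ^ 2 * (p / N ^ 2)) * D + 2 * τ * L + τ ^ 2 * Q)| ≤
      (2 * κ₂ + τ ^ 2 + 4 * τ) / N * ((1 + L ^ 2 + Q ^ 2) * (1 + D ^ 2)) := by
  have hN0 : 0 < N := by linarith
  set x := r / N with hx
  have hx0 : 0 ≤ x := by positivity
  have hx2 : x ^ 2 = 1 + D / N := by
    rw [hx, div_pow, hr2]
    field_simp
  have hrx : r = N * x := by rw [hx]; field_simp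
  have hinv : 1 / N ≤ 1 := by rw [div_le_one hN0]; exact hN
  -- The exact remainder of the linearization.
  have hrem : (τ ^ 2 * (N ^ 2 + N * D) * (T + N * Q) + 2 * τ * r ^ 3 * L +
        κ₂ * (N ^ 2 + N * D) ^ 2 - (N ^ 2) ^ 2 * κ₂ - p * N ^ 2 * τ ^ 2) / N ^ 3 -
      ((2 * κ₂ + τ ^ 2 * (p / N ^ 2)) * D + 2 * τ * L + τ ^ 2 * Q) =
      (-κ₂ - κ₂ * (1 / N) * D + τ ^ 2 * D * Q + κ₂ * D ^ 2) / N + 2 * τ * (x ^ 3 - 1) * L := by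
    have e1 : τ ^ 2 * (N ^ 2 + N * D) * (T + N * Q) =
        (N ^ 2 + N * D) * (τ ^ 2 * p - κ₂) + τ ^ 2 * (N ^ 2 + N * D) * (N * Q) := by
      rw [← hT]; ring
    rw [e1, hrx]
    field_simp
    ring
  have hcube : |x ^ 3 - 1| ≤ (2 * |D| + D ^ 2) / N := by
    have hD : |x - 1| * (x + 1) = |D| / N := by
      have h := congrArg abs (show (x - 1) * (x + 1) = D / N by linear_combination hx2)
      rwa [abs_mul, abs_div, abs_of_pos hN0, abs_of_nonneg (show 0 ≤ x + 1 by linarith)] at h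
    have h1 : |x - 1| ≤ |D| := by
      have h2 : |D| / N ≤ |D| := div_le_self (abs_nonneg _) hN
      nlinarith [mul_nonneg (abs_nonneg (x - 1)) hx0]
    have h3 : x ≤ 1 + |D| := by linarith [le_abs_self (x - 1)]
    calc |x ^ 3 - 1| = |x - 1| * (x ^ 2 + x + 1) := by
          rw [show x ^ 3 - 1 = (x - 1) * (x ^ 2 + x + 1) by ring, abs_mul,
            abs_of_nonneg (show 0 ≤ x ^ 2 + x + 1 by positivity)]
      _ ≤ |x - 1| * ((x + 1) * (x + 1)) := by
          gcongr
          nlinarith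
      _ = |D| / N * (x + 1) := by rw [← mul_assoc, hD]
      _ ≤ |D| / N * (2 + |D|) :=
          mul_le_mul_of_nonneg_left (by linarith) (by positivity)
      _ = (2 * |D| + D ^ 2) / N := by rw [← sq_abs D]; ring
  rw [hrem]
  have hfirst : |(-κ₂ - κ₂ * (1 / N) * D + τ ^ 2 * D * Q + κ₂ * D ^ 2) / N| ≤
      (κ₂ + κ₂ * |D| + τ ^ 2 * (|D| * |Q|) + κ₂ * D ^ 2) / N := by
    rw [abs_div, abs_of_pos hN0]
    gcongr
    have e1 : |κ₂ * (1 / N) * D| ≤ κ₂ * |D| := by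
      rw [abs_mul, abs_of_nonneg (show 0 ≤ κ₂ * (1 / N) by positivity)]
      gcongr
      exact mul_le_of_le_one_right hκ hinv
    have e2 : |τ ^ 2 * D * Q| = τ ^ 2 * (|D| * |Q|) := by
      rw [mul_assoc, abs_mul, abs_mul, abs_of_nonneg (sq_nonneg τ)]
    have e3 : |κ₂ * D ^ 2| = κ₂ * D ^ 2 := abs_of_nonneg (by positivity)
    have e4 : |-κ₂| = κ₂ := by rw [abs_neg, abs_of_nonneg hκ]
    calc _ ≤ |-κ₂| + |κ₂ * (1 / N) * D| + |τ ^ 2 * D * Q| + |κ₂ * D ^ 2| := by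
          refine (abs_add_le _ _).trans (add_le_add_left ((abs_add_le _ _).trans
            (add_le_add_left (abs_sub _ _) _)) _)
      _ ≤ _ := by rw [e2, e3, e4]; linarith
  have hsecond : |2 * τ * (x ^ 3 - 1) * L| ≤ 2 * τ * ((2 * |D| + D ^ 2) * |L|) / N := by
    rw [abs_mul, abs_mul, abs_of_pos (show 0 < 2 * τ by linarith)]
    calc 2 * τ * |x ^ 3 - 1| * |L| ≤ 2 * τ * ((2 * |D| + D ^ 2) / N) * |L| := by gcongr
      _ = _ := by ring
  refine (abs_add_le _ _).trans ((add_le_add hfirst hsecond).trans ?_)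
  rw [← add_div, div_mul_eq_mul_div]
  gcongr
  rw [← sq_abs D, ← sq_abs L, ← sq_abs Q]
  have hd := abs_nonneg D
  have hl := abs_nonneg L
  have hq := abs_nonneg Q
  generalize |D| = d at *
  generalize |L| = l at *
  generalize |Q| = u at *
  have f1 : 1 + d + d ^ 2 ≤ 2 * ((1 + l ^ 2 + u ^ 2) * (1 + d ^ 2)) := by
    linarith [sq_nonneg (d - 1), mul_nonneg (sq_nonneg l) (sq_nonneg d),
      mul_nonneg (sq_nonneg u) (sq_nonneg d), sq_nonneg l, sq_nonneg u, sq_nonneg d]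
  have f2 : d * u ≤ (1 + l ^ 2 + u ^ 2) * (1 + d ^ 2) := by
    linarith [sq_nonneg (d - u), mul_nonneg (sq_nonneg l) (sq_nonneg d),
      mul_nonneg (sq_nonneg u) (sq_nonneg d), sq_nonneg l, sq_nonneg u, sq_nonneg d]
  have f3 : (2 * d + d ^ 2) * l ≤ 2 * ((1 + l ^ 2 + u ^ 2) * (1 + d ^ 2)) := by
    linarith [sq_nonneg (d - l), mul_nonneg (sq_nonneg d) (sq_nonneg (l - 1)),
      mul_nonneg (sq_nonneg l) (sq_nonneg d), mul_nonneg (sq_nonneg u) (sq_nonneg d),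
      sq_nonneg l, sq_nonneg u, sq_nonneg d]
  have g1 := mul_le_mul_of_nonneg_left f1 hκ
  have g2 := mul_le_mul_of_nonneg_left f2 (sq_nonneg τ)
  have g3 := mul_le_mul_of_nonneg_left f3 (show 0 ≤ 2 * τ by linarith)
  linarith

/-! ### Second moments of the linearization -/

/-- Second moment of a linear combination of independent centred copies. -/
lemma integral_sq_sum_pi {ι : Type*} [Fintype ι] {f : ℝ → ℝ} {μ : Measure ℝ}
    [IsProbabilityMeasure μ] (hf : MemLp f 2 μ) (h0 : ∫ x, f x ∂μ = 0) (c : ι → ℝ) :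
    Integrable (fun h : ι → ℝ => (∑ i, c i * f (h i)) ^ 2) (Measure.pi fun _ => μ) ∧
      ∫ h, (∑ i, c i * f (h i)) ^ 2 ∂(Measure.pi fun _ : ι => μ) =
        (∑ i, c i ^ 2) * ∫ x, f x ^ 2 ∂μ := by
  have hmem (i : ι) : MemLp (fun h : ι → ℝ => c i * f (h i)) 2 (Measure.pi fun _ => μ) :=
    (hf.comp_measurePreserving (measurePreserving_eval (fun _ : ι => μ) i)).const_mul (c i)
  have hsum : MemLp (fun h : ι → ℝ => ∑ i, c i * f (h i)) 2 (Measure.pi fun _ => μ) :=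
    memLp_finsetSum _ fun i _ => hmem i
  refine ⟨hsum.integrable_sq, ?_⟩
  have hint (i : ι) : ∫ h : ι → ℝ, c i * f (h i) ∂(Measure.pi fun _ => μ) = 0 := by
    rw [integral_const_mul]
    have h1 : ∫ h : ι → ℝ, f (h i) ∂(Measure.pi fun _ => μ) = ∫ x, f x ∂μ := by
      have hmp := measurePreserving_eval (fun _ : ι => μ) i
      conv_rhs => rw [← hmp.map_eq]
      rw [integral_map hmp.aemeasurable (by rw [hmp.map_eq]; exact hf.aestronglyMeasurable)]
    rw [h1, h0, mul_zero]
  have hzero : ∫ h : ι → ℝ, ∑ i, c i * f (h i) ∂(Measure.pi fun _ => μ) = 0 := by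
    rw [integral_finsetSum _ fun i _ => (hmem i).integrable one_le_two]
    simp [hint]
  rw [← variance_of_integral_eq_zero hsum.aestronglyMeasurable.aemeasurable hzero,
    ← variance_of_integral_eq_zero hf.aestronglyMeasurable.aemeasurable h0, Finset.sum_mul]
  have h2 := variance_sum_pi (μ := fun _ : ι => μ) (X := fun i x => c i * f x)
    fun i => hf.const_mul (c i)
  simp_rw [variance_const_mul] at h2
  rw [← h2]
  congr 1
  ext h
  simp

lemma memLp_sq_sub_one_gaussianReal : MemLp (fun x : ℝ => x ^ 2 - 1) 2 (gaussianReal 0 1) := by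
  have h1 : MemLp (fun x : ℝ => x ^ 2) 2 (gaussianReal 0 1) := by
    rw [memLp_two_iff_integrable_sq (by fun_prop)]
    have h := (memLp_id_gaussianReal' (μ := 0) (v := 1) 4 (by simp)).integrable_norm_pow
      (by norm_num)
    refine h.congr (Eventually.of_forall fun x => ?_)
    simp only [id, Real.norm_eq_abs, ← pow_mul]
    norm_num
    exact Even.pow_abs (by decide) x
  exact h1.sub (memLp_const 1)

lemma integral_sq_gaussianReal : ∫ x, x ^ 2 ∂(gaussianReal 0 1) = 1 := by
  have h := variance_of_integral_eq_zero (X := id) (μ := gaussianReal 0 1) aemeasurable_id (by simp)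
  rw [variance_id_gaussianReal] at h
  simpa using h.symm

lemma integral_sq_sub_one_gaussianReal : ∫ x : ℝ, (x ^ 2 - 1) ∂(gaussianReal 0 1) = 0 := by
  have h1 : Integrable (fun x : ℝ => x ^ 2) (gaussianReal 0 1) :=
    (memLp_id_gaussianReal (μ := 0) (v := 1) 2).integrable_sq
  rw [integral_sub h1 (integrable_const _), integral_sq_gaussianReal]
  simp

/-! ### Characteristic function of the normalized statistic -/

lemma norm_cexp_sub_cexp_le (x y : ℝ) :
    ‖Complex.exp (x * Complex.I) - Complex.exp (y * Complex.I)‖ ≤ |x - y| := by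
  have h : Complex.exp (x * Complex.I) - Complex.exp (y * Complex.I) =
      Complex.exp (y * Complex.I) * (Complex.exp (Complex.I * (x - y : ℝ)) - 1) := by
    rw [mul_sub, ← Complex.exp_add, mul_one]
    congr 2
    push_cast
    ring
  rw [h, norm_mul, Complex.norm_exp_ofReal_mul_I, one_mul, ← Real.norm_eq_abs]
  exact Real.norm_exp_I_mul_ofReal_sub_one_le

@[fun_prop]
lemma measurable_quadStat {ι κ : Type*} [Fintype ι] [Fintype κ] (τ κ₂ : ℝ) (a lam : ι → ℝ) :
    Measurable (quadStat (κ := κ) τ κ₂ a lam) := by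
  unfold quadStat
  fun_prop

open Complex in
/-- The characteristic function of the normalized statistic differs from that of its
linearization, a product over independent coordinates, by `O(n ^ (-1/2))`. -/
lemma norm_integral_cexp_quadStat_sub_le {ι : Type*} [Fintype ι] {n : ℕ} (hn : 0 < n)
    {τ κ₂ p : ℝ} (hτ : 0 < τ) (hκ : 0 ≤ κ₂) (a lam : ι → ℝ)
    (hT : τ ^ 2 * ∑ j, lam j = τ ^ 2 * p - κ₂) (t : ℝ) :
    ‖∫ z, cexp ((t * ((quadStat τ κ₂ a lam z - (n : ℝ) ^ 2 * κ₂ - p * n * τ ^ 2) /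
          √n ^ 3) : ℝ) * I)
        ∂((Measure.pi fun _ : ι => gaussianReal 0 1).prod
          (Measure.pi fun _ : Fin n => gaussianReal 0 1)) -
      (∏ j, ∫ x, cexp ((t * (2 * τ * a j * x + τ ^ 2 * lam j / √n * (x ^ 2 - 1)) : ℝ) * I)
        ∂(gaussianReal 0 1)) *
      ∏ _i : Fin n, ∫ x, cexp ((t * (0 * x + (2 * κ₂ + τ ^ 2 * (p / n)) / √n * (x ^ 2 - 1)) : ℝ) * I)
        ∂(gaussianReal 0 1)‖ ≤
      |t| * ((2 * κ₂ + τ ^ 2 + 4 * τ) / √n * ((1 + ∑ j, a j ^ 2 +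
        (∑ j, lam j ^ 2) / n * ∫ x, (x ^ 2 - 1) ^ 2 ∂(gaussianReal 0 1)) *
          (1 + ∫ x, (x ^ 2 - 1) ^ 2 ∂(gaussianReal 0 1)))) := by
  set N := √(n : ℝ) with hN
  have hN2 : N ^ 2 = n := Real.sq_sqrt (Nat.cast_nonneg n)
  have hN1 : 1 ≤ N := by
    rw [hN, Real.one_le_sqrt]
    exact_mod_cast hn
  have hN0 : 0 < N := by linarith
  set D : (Fin n → ℝ) → ℝ := fun h => ∑ i, N⁻¹ * (h i ^ 2 - 1) with hD
  set L : (ι → ℝ) → ℝ := fun g => ∑ j, a j * g j with hL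
  set Q : (ι → ℝ) → ℝ := fun g => ∑ j, lam j / N * (g j ^ 2 - 1) with hQ
  set K := ∫ x : ℝ, (x ^ 2 - 1) ^ 2 ∂(gaussianReal 0 1) with hK
  obtain ⟨hDi, hDe⟩ := integral_sq_sum_pi memLp_sq_sub_one_gaussianReal
    integral_sq_sub_one_gaussianReal (fun _ : Fin n => N⁻¹)
  obtain ⟨hLi, hLe⟩ := integral_sq_sum_pi (f := fun x => x)
    (memLp_id_gaussianReal (μ := 0) (v := 1) 2) (by simp) a
  obtain ⟨hQi, hQe⟩ := integral_sq_sum_pi memLp_sq_sub_one_gaussianReal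
    integral_sq_sub_one_gaussianReal (fun j => lam j / N)
  rw [integral_sq_gaussianReal, mul_one] at hLe
  have hDe' : ∫ h, D h ^ 2 ∂(Measure.pi fun _ : Fin n => gaussianReal 0 1) = K := by
    rw [hD, hDe, Finset.sum_const, Finset.card_univ, Fintype.card_fin, nsmul_eq_mul, ← hN2]
    field_simp
    rfl
  have hQe' : ∫ g, Q g ^ 2 ∂(Measure.pi fun _ : ι => gaussianReal 0 1) =
      (∑ j, lam j ^ 2) / n * K := by
    rw [hQ, hQe]
    simp_rw [div_pow, hN2, ← Finset.sum_div]
    rfl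
  set M : (ι → ℝ) × (Fin n → ℝ) → ℝ := fun z =>
    (2 * κ₂ + τ ^ 2 * (p / n)) * D z.2 + 2 * τ * L z.1 + τ ^ 2 * Q z.1 with hM
  set B : (ι → ℝ) × (Fin n → ℝ) → ℝ := fun z =>
    (1 + L z.1 ^ 2 + Q z.1 ^ 2) * (1 + D z.2 ^ 2) with hB
  have hpoint (z : (ι → ℝ) × (Fin n → ℝ)) :
      |(quadStat τ κ₂ a lam z - (n : ℝ) ^ 2 * κ₂ - p * n * τ ^ 2) / N ^ 3 - M z| ≤
        (2 * κ₂ + τ ^ 2 + 4 * τ) / N * B z := by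
    have hq : ∑ i, z.2 i ^ 2 = N ^ 2 + N * D z.2 := by
      rw [hD]
      simp only [← Finset.mul_sum, Finset.sum_sub_distrib, Finset.sum_const, Finset.card_univ,
        Fintype.card_fin, nsmul_eq_mul, hN2, mul_one]
      field_simp
      ring
    have hu : ∑ j, lam j * z.1 j ^ 2 = ∑ j, lam j + N * Q z.1 := by
      rw [hQ]
      simp only [Finset.mul_sum, ← Finset.sum_add_distrib]
      refine Finset.sum_congr rfl fun j _ => ?_
      field_simp
      ring
    have hq0 : 0 ≤ N ^ 2 + N * D z.2 := hq ▸ Finset.sum_nonneg fun i _ => sq_nonneg _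
    have := abs_normalized_sub_linear_le (Q := Q z.1) (L := L z.1) hN1 hτ hκ (Real.sqrt_nonneg _)
      (Real.sq_sqrt hq0) hT
    rw [quadStat, hq, hu, hM, hB, ← hN2]
    exact this
  have hBint : Integrable B ((Measure.pi fun _ : ι => gaussianReal 0 1).prod
      (Measure.pi fun _ : Fin n => gaussianReal 0 1)) :=
    Integrable.mul_prod (f := fun g => 1 + L g ^ 2 + Q g ^ 2) (g := fun h => 1 + D h ^ 2)
      (((integrable_const 1).add hLi).add hQi) ((integrable_const 1).add hDi)
  have hBval : ∫ z, B z ∂((Measure.pi fun _ : ι => gaussianReal 0 1).prod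
      (Measure.pi fun _ : Fin n => gaussianReal 0 1)) =
      (1 + ∑ j, a j ^ 2 + (∑ j, lam j ^ 2) / n * K) * (1 + K) := by
    rw [hB, integral_prod_mul (fun g => 1 + L g ^ 2 + Q g ^ 2) (fun h => 1 + D h ^ 2),
      integral_add (f := fun g => 1 + L g ^ 2) ((integrable_const 1).add hLi) hQi,
      integral_add (f := fun _ => (1 : ℝ)) (integrable_const 1) hLi,
      integral_add (integrable_const 1) hDi, hLe, hQe', hDe']
    simp
  -- The characteristic function of the linearization factors over the coordinates.
  have hprod : (∏ j, ∫ x, cexp ((t * (2 * τ * a j * x + τ ^ 2 * lam j / N * (x ^ 2 - 1)) : ℝ) * I)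
        ∂(gaussianReal 0 1)) *
      ∏ _i : Fin n, ∫ x, cexp ((t * (0 * x + (2 * κ₂ + τ ^ 2 * (p / n)) / N * (x ^ 2 - 1)) : ℝ) * I)
        ∂(gaussianReal 0 1) =
      ∫ z, cexp ((t * M z : ℝ) * I) ∂((Measure.pi fun _ : ι => gaussianReal 0 1).prod
          (Measure.pi fun _ : Fin n => gaussianReal 0 1)) := by
    rw [← integral_fintype_prod_eq_prod (f := fun j (x : ℝ) =>
        cexp ((t * (2 * τ * a j * x + τ ^ 2 * lam j / N * (x ^ 2 - 1)) : ℝ) * I)),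
      ← integral_fintype_prod_eq_prod (f := fun (_ : Fin n) (x : ℝ) =>
        cexp ((t * (0 * x + (2 * κ₂ + τ ^ 2 * (p / n)) / N * (x ^ 2 - 1)) : ℝ) * I)),
      ← integral_prod_mul]
    refine integral_congr_ae (Eventually.of_forall fun z => ?_)
    simp only
    rw [← Complex.exp_sum, ← Complex.exp_sum, ← Complex.exp_add, ← Finset.sum_mul, ← Finset.sum_mul,
      ← add_mul, ← ofReal_sum, ← ofReal_sum, ← ofReal_add, ← Finset.mul_sum, ← Finset.mul_sum,
      ← mul_add]
    congr 4
    simp only [hM, hD, hL, hQ, Finset.mul_sum]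
    rw [add_comm, add_assoc, ← Finset.sum_add_distrib]
    congr 1
    · exact Finset.sum_congr rfl fun i _ => by ring
    · exact Finset.sum_congr rfl fun j _ => by ring
  have hint {f : (ι → ℝ) × (Fin n → ℝ) → ℝ} (hf : Measurable f) :
      Integrable (fun z => cexp ((t * f z : ℝ) * I))
        ((Measure.pi fun _ : ι => gaussianReal 0 1).prod
          (Measure.pi fun _ : Fin n => gaussianReal 0 1)) := by
    refine Integrable.of_bound (Measurable.aestronglyMeasurable (by fun_prop)) 1
      (Eventually.of_forall fun z => ?_)
    rw [Complex.norm_exp_ofReal_mul_I]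
  rw [hprod, ← integral_sub (hint (by fun_prop)) (hint (by fun_prop)), ← hBval, ← integral_const_mul,
    ← integral_const_mul]
  refine norm_integral_le_of_norm_le ((hBint.const_mul _).const_mul _)
    (Eventually.of_forall fun z => ?_)
  refine (norm_cexp_sub_cexp_le _ _).trans ?_
  rw [← mul_sub, abs_mul]
  exact mul_le_mul_of_nonneg_left (hpoint z) (abs_nonneg t)

/-! ### Asymptotic normality -/

lemma trace_residualCov {ι : Type*} [Fintype ι] (A : Matrix ι ι ℝ) (β : ι → ℝ) (σ : ℝ) :
    (residualCov A β σ).trace =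
      A.trace - (β ⬝ᵥ A *ᵥ β + σ ^ 2)⁻¹ * ((A *ᵥ β) ⬝ᵥ (A *ᵥ β)) := by
  rw [residualCov, Matrix.trace_sub, Matrix.trace_smul, Matrix.trace_vecMulVec, smul_eq_mul]

lemma trace_residualCov_mul_self {ι : Type*} [Fintype ι] {A : Matrix ι ι ℝ} (β : ι → ℝ) (σ : ℝ) :
    (residualCov A β σ * residualCov A β σ).trace =
      (A * A).trace - 2 * (β ⬝ᵥ A *ᵥ β + σ ^ 2)⁻¹ * ((A *ᵥ β) ⬝ᵥ A *ᵥ (A *ᵥ β)) +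
        (β ⬝ᵥ A *ᵥ β + σ ^ 2)⁻¹ ^ 2 * ((A *ᵥ β) ⬝ᵥ (A *ᵥ β)) ^ 2 := by
  set b := A *ᵥ β with hb
  rw [residualCov, ← hb, sub_mul, mul_sub, mul_sub]
  simp only [Matrix.trace_sub, Matrix.smul_mul, Matrix.mul_smul, Matrix.trace_smul, smul_eq_mul,
    Matrix.mul_vecMulVec, Matrix.trace_vecMulVec, Matrix.trace_mul_comm (Matrix.vecMulVec b b) A]
  rw [Matrix.smul_mulVec, Matrix.vecMulVec_mulVec, op_smul_eq_smul, smul_dotProduct,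
    smul_dotProduct, smul_eq_mul, smul_eq_mul, dotProduct_comm (A *ᵥ b) b]
  ring

lemma trace_kmsMatrix (ρ : ℝ) (p : ℕ) : (kmsMatrix ρ p).trace = p := by
  simp [Matrix.trace, kmsMatrix_apply, kmsEntry]

lemma trace_kmsMatrix_mul_self (ρ : ℝ) (p : ℕ) :
    (kmsMatrix ρ p * kmsMatrix ρ p).trace = ∑ i : Fin p, ∑ j : Fin p, kmsEntry (ρ ^ 2) i j := by
  simp only [Matrix.trace, Matrix.diag_apply, Matrix.mul_apply, kmsMatrix_apply]
  refine Finset.sum_congr rfl fun i _ => Finset.sum_congr rfl fun j _ => ?_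
  rw [kmsEntry_comm ρ j i, ← sq, kmsEntry, kmsEntry, ← pow_mul, ← pow_mul, mul_comm]

/-- Characteristic functions of the statistics, with the coefficients of the spectral
representation given, converge to that of the Gaussian limit. -/
lemma tendsto_integral_cexp_quadStat {p : ℕ → ℕ} {c : ℝ}
    (hpn : Tendsto (fun n => (p n : ℝ) / (n : ℝ)) atTop (𝓝 c)) {v κ₂ : ℕ → ℝ} {v' κ₂' T s : ℝ}
    (hv0 : ∀ n, 0 < v n) (hκ0 : ∀ n, 0 ≤ κ₂ n) (hv : Tendsto v atTop (𝓝 v'))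
    (hκ : Tendsto κ₂ atTop (𝓝 κ₂')) (a lam : (n : ℕ) → Fin (p n) → ℝ) {C : ℝ}
    (hlam0 : ∀ n j, 0 ≤ lam n j) (hlamC : ∀ n j, lam n j ≤ C)
    (htr : ∀ n, v n * ∑ j, lam n j = v n * p n - κ₂ n)
    (hT : Tendsto (fun n => (∑ j, lam n j ^ 2) / n) atTop (𝓝 T))
    (hs : Tendsto (fun n => ∑ j, a n j ^ 2) atTop (𝓝 s)) (t : ℝ) :
    Tendsto (fun n : ℕ => ∫ z, Complex.exp ((t * ((quadStat (√(v n)) (κ₂ n) (a n) (lam n) z -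
          (n : ℝ) ^ 2 * κ₂ n - p n * n * v n) / √n ^ 3) : ℝ) * Complex.I)
        ∂((Measure.pi fun _ : Fin (p n) => gaussianReal 0 1).prod
          (Measure.pi fun _ : Fin n => gaussianReal 0 1))) atTop
      (𝓝 (Complex.exp ((-(t ^ 2 / 2 *
        (2 * (2 * κ₂' + v' * c) ^ 2 + (4 * v' * s + 2 * v' ^ 2 * T))) : ℝ)))) := by
  have hsqrt : Tendsto (fun n : ℕ => (√(n : ℝ))⁻¹) atTop (𝓝 0) :=
    (Real.tendsto_sqrt_atTop.comp tendsto_natCast_atTop_atTop).inv_tendsto_atTop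
  have hsq (n : ℕ) : √(v n) ^ 2 = v n := Real.sq_sqrt (hv0 n).le
  have hnsq (n : ℕ) : √(n : ℝ) ^ 2 = n := Real.sq_sqrt (Nat.cast_nonneg n)
  -- Coordinates coming from the residuals.
  have h1 := tendsto_prod_charFun_quadratic (fun n j => 2 * √(v n) * a n j)
    (fun n j => √(v n) ^ 2 * lam n j / √n) (fun n => v n * C * (√(n : ℝ))⁻¹)
    (by simpa using (hv.mul_const C).mul hsqrt)
    (Eventually.of_forall fun n j => by
      rw [hsq, abs_of_nonneg (div_nonneg (mul_nonneg (hv0 n).le (hlam0 n j)) (Real.sqrt_nonneg _)),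
        div_eq_mul_inv]
      gcongr
      · exact (hv0 n).le
      · exact hlamC n j)
    (4 * v' * s + 2 * v' ^ 2 * T)
    (by
      have h := ((hv.const_mul 4).mul hs).add (((hv.pow 2).const_mul 2).mul hT)
      refine h.congr fun n => ?_
      simp only [mul_pow, div_pow, hsq, hnsq, Finset.sum_add_distrib, ← Finset.mul_sum,
        ← Finset.sum_div]
      ring) t
  -- Coordinates coming from the responses.
  have hcoef : Tendsto (fun n : ℕ => 2 * κ₂ n + √(v n) ^ 2 * ((p n : ℝ) / n)) atTop
      (𝓝 (2 * κ₂' + v' * c)) := by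
    simp_rw [hsq]
    exact (hκ.const_mul 2).add (hv.mul hpn)
  have h2 := tendsto_prod_charFun_quadratic (ι := fun n => Fin n) (fun n _ => 0)
    (fun n _ => (2 * κ₂ n + √(v n) ^ 2 * ((p n : ℝ) / n)) / √n)
    (fun n => |2 * κ₂ n + √(v n) ^ 2 * ((p n : ℝ) / n)| * (√(n : ℝ))⁻¹)
    (by simpa using hcoef.abs.mul hsqrt)
    (Eventually.of_forall fun n _ => by
      rw [abs_div, abs_of_nonneg (Real.sqrt_nonneg _), div_eq_mul_inv])
    (2 * (2 * κ₂' + v' * c) ^ 2)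
    (by
      refine ((hcoef.pow 2).const_mul 2).congr' ?_
      filter_upwards [eventually_gt_atTop 0] with n hn
      have hn' : (n : ℝ) ≠ 0 := by exact_mod_cast hn.ne'
      simp only [Finset.sum_const, Finset.card_univ, Fintype.card_fin, nsmul_eq_mul, div_pow, hnsq]
      field_simp
      ring) t
  have h12 := h1.mul h2
  rw [← Complex.exp_add, ← Complex.ofReal_add] at h12
  have hval : -(t ^ 2 / 2 * (4 * v' * s + 2 * v' ^ 2 * T)) +
      -(t ^ 2 / 2 * (2 * (2 * κ₂' + v' * c) ^ 2)) =
      -(t ^ 2 / 2 * (2 * (2 * κ₂' + v' * c) ^ 2 + (4 * v' * s + 2 * v' ^ 2 * T))) := by ring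
  rw [hval] at h12
  refine (tendsto_iff_of_dist ?_).1 h12
  -- The remainder bound tends to zero.
  set K := ∫ x : ℝ, (x ^ 2 - 1) ^ 2 ∂(gaussianReal 0 1) with hK
  have hbound : Tendsto (fun n : ℕ => |t| * ((2 * κ₂ n + √(v n) ^ 2 + 4 * √(v n)) / √n *
      ((1 + ∑ j, a n j ^ 2 + (∑ j, lam n j ^ 2) / n * K) * (1 + K)))) atTop (𝓝 0) := by
    have h3 : Tendsto (fun n => 2 * κ₂ n + √(v n) ^ 2 + 4 * √(v n)) atTop
        (𝓝 (2 * κ₂' + √v' ^ 2 + 4 * √v')) :=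
      ((hκ.const_mul 2).add (hv.sqrt.pow 2)).add (hv.sqrt.const_mul 4)
    have h4 := (((hs.const_add 1).add (hT.mul_const K)).mul_const (1 + K))
    have h5 := ((h3.mul hsqrt).mul h4).const_mul |t|
    simpa [div_eq_mul_inv] using h5
  refine squeeze_zero' (Eventually.of_forall fun n => dist_nonneg) ?_ hbound
  filter_upwards [eventually_gt_atTop 0] with n hn
  rw [dist_comm, dist_eq_norm]
  have h6 := norm_integral_cexp_quadStat_sub_le hn (Real.sqrt_pos.2 (hv0 n)) (hκ0 n) (a n) (lam n)
    (p := p n) (by rw [hsq]; exact htr n) t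
  rw [← hK] at h6
  convert h6 using 1
  simp only [hsq]

theorem theorem1 {Ω : ℕ → Type*} [∀ n, MeasurableSpace (Ω n)]
    (P : (n : ℕ) → Measure (Ω n)) [∀ n, IsProbabilityMeasure (P n)]
    (ρ : ℝ) (hρ : |ρ| < 1) (σ : ℝ) (hσ : 0 < σ)
    (β : ℕ → ℝ) (hβ : Summable fun j => β j ^ 2)
    (p : ℕ → ℕ) (hp : Tendsto p atTop atTop)
    (c : ℝ) (hc : 0 < c) (hpn : Tendsto (fun n => (p n : ℝ) / (n : ℝ)) atTop (𝓝 c))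
    (X : (n : ℕ) → Ω n → Fin n → Fin (p n) → ℝ) (ε Y : (n : ℕ) → Ω n → Fin n → ℝ)
    (hmodel : ∀ n, IsKMSRegression (P n) ρ σ (coeffVec β (p n)) (X n) (ε n) (Y n)) :
    ∃ κ₁ κ₂ κ₃ : ℝ,
      Tendsto (kappa1 β ρ) atTop (𝓝 κ₁) ∧
      Tendsto (kappa2 β ρ) atTop (𝓝 κ₂) ∧
      Tendsto (kappa3 β ρ) atTop (𝓝 κ₃) ∧
      0 ≤ limitVar κ₁ κ₂ κ₃ σ c ρ ∧
      TendstoInDistribution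
        (fun (n : ℕ) (ω : Ω n) =>
          (sqNormXtY (X n ω) (Y n ω) - (n : ℝ) ^ 2 * kappa2 β ρ (p n)
            - (p n : ℝ) * (n : ℝ) * (kappa1 β ρ (p n) + σ ^ 2)) / (n : ℝ) ^ (3 / 2 : ℝ))
        atTop (id : ℝ → ℝ) P
        (gaussianReal 0 (limitVar κ₁ κ₂ κ₃ σ c ρ).toNNReal) := by
  obtain ⟨κ₁, hκ₁⟩ := exists_tendsto_kappa1 hρ hβ
  obtain ⟨κ₂, hκ₂⟩ := exists_tendsto_kappa2 hρ hβ
  obtain ⟨κ₃, hκ₃⟩ := exists_tendsto_kappa3 hρ hβ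
  choose hmeas a lam hlam0 hlamC htr htr2 ha hlaw using
    fun n => (hmodel n).exists_map_sqNormXtY_eq hρ hσ
  simp only [trace_residualCov, trace_residualCov_mul_self, dotProduct_residualCov_mulVec,
    ← kappa1_eq_dotProduct, ← kappa2_eq_dotProduct, ← kappa3_eq_dotProduct, trace_kmsMatrix,
    trace_kmsMatrix_mul_self] at htr htr2 ha hlaw
  set v : ℕ → ℝ := fun n => kappa1 β ρ (p n) + σ ^ 2 with hv
  have hκ₁0 (q : ℕ) : 0 ≤ kappa1 β ρ q := by
    rw [kappa1_eq_dotProduct]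
    simpa using (kmsMatrix_posSemidef hρ.le q).dotProduct_mulVec_nonneg (coeffVec β q)
  have hκ₂0 (q : ℕ) : 0 ≤ kappa2 β ρ q := Finset.sum_nonneg fun _ _ => sq_nonneg _
  have hv0 (n : ℕ) : 0 < v n := by
    have := hκ₁0 (p n)
    positivity
  have hv' : Tendsto v atTop (𝓝 (κ₁ + σ ^ 2)) := (hκ₁.comp hp).add_const _
  have hv'0 : 0 < κ₁ + σ ^ 2 := by
    have : 0 ≤ κ₁ := ge_of_tendsto' hκ₁ hκ₁0
    positivity
  have hvinv : Tendsto (fun n => (v n)⁻¹) atTop (𝓝 (κ₁ + σ ^ 2)⁻¹) := hv'.inv₀ hv'0.ne'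
  have hκ₂' : Tendsto (fun n => kappa2 β ρ (p n)) atTop (𝓝 κ₂) := hκ₂.comp hp
  have hκ₃' : Tendsto (fun n => kappa3 β ρ (p n)) atTop (𝓝 κ₃) := hκ₃.comp hp
  have hρ2 : ρ ^ 2 < 1 := by rw [← sq_abs]; nlinarith [abs_nonneg ρ]
  have hninv : Tendsto (fun n : ℕ => (n : ℝ)⁻¹) atTop (𝓝 0) := tendsto_inv_atTop_nhds_zero_nat
  have hA : Tendsto (fun n => ∑ j, a n j ^ 2) atTop (𝓝 (κ₃ - (κ₁ + σ ^ 2)⁻¹ * κ₂ ^ 2)) := by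
    simp_rw [ha]
    exact hκ₃'.sub (hvinv.mul (hκ₂'.pow 2))
  have hT : Tendsto (fun n => (∑ j, lam n j ^ 2) / n) atTop
      (𝓝 ((1 + ρ ^ 2) / (1 - ρ ^ 2) * c)) := by
    have h1 := ((tendsto_sum_kmsEntry_div (sq_nonneg ρ) hρ2).comp hp).mul hpn
    -- The rank-one correction to the covariance matrix is negligible in the trace.
    have h2 := ((((hvinv.const_mul 2).mul hκ₃').neg).add ((hvinv.pow 2).mul (hκ₂'.pow 2))).mul hninv
    rw [mul_zero] at h2
    have h3 := h1.add h2
    rw [add_zero] at h3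
    refine h3.congr' ?_
    filter_upwards [hp.eventually_gt_atTop 0] with n hn
    have hn' : (p n : ℝ) ≠ 0 := by exact_mod_cast hn.ne'
    rw [htr2]
    change _ / (p n : ℝ) * ((p n : ℝ) / n) + _ = _
    rw [div_mul_div_cancel₀ hn']
    simp only [hv]
    ring
  have hvar : 2 * (2 * κ₂ + (κ₁ + σ ^ 2) * c) ^ 2 +
      (4 * (κ₁ + σ ^ 2) * (κ₃ - (κ₁ + σ ^ 2)⁻¹ * κ₂ ^ 2) +
        2 * (κ₁ + σ ^ 2) ^ 2 * ((1 + ρ ^ 2) / (1 - ρ ^ 2) * c)) = limitVar κ₁ κ₂ κ₃ σ c ρ := by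
    rw [limitVar]
    have : (κ₁ + σ ^ 2) * (κ₁ + σ ^ 2)⁻¹ = 1 := mul_inv_cancel₀ hv'0.ne'
    linear_combination (-4 * κ₂ ^ 2) * this
  have hA0 : 0 ≤ κ₃ - (κ₁ + σ ^ 2)⁻¹ * κ₂ ^ 2 :=
    ge_of_tendsto' hA fun n => Finset.sum_nonneg fun _ _ => sq_nonneg _
  have hvar0 : 0 ≤ limitVar κ₁ κ₂ κ₃ σ c ρ := by
    rw [← hvar]
    have : 0 < 1 - ρ ^ 2 := by linarith
    positivity
  refine ⟨κ₁, κ₂, κ₃, hκ₁, hκ₂, hκ₃, hvar0, ?_⟩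
  have hm (n : ℕ) : AEMeasurable (fun ω : Ω n =>
      (sqNormXtY (X n ω) (Y n ω) - (n : ℝ) ^ 2 * kappa2 β ρ (p n)
        - (p n : ℝ) * (n : ℝ) * (kappa1 β ρ (p n) + σ ^ 2)) / (n : ℝ) ^ (3 / 2 : ℝ)) (P n) :=
    (((hmeas n).sub_const _).sub_const _).div_const _
  refine ⟨hm, aemeasurable_id, ?_⟩
  refine ProbabilityMeasure.tendsto_iff_tendsto_charFun.2 fun t => ?_
  have hlim := tendsto_integral_cexp_quadStat hpn hv0 (fun n => hκ₂0 (p n)) hv' hκ₂' a lam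
    hlam0 hlamC (fun n => by
      rw [htr, mul_sub, ← mul_assoc, mul_inv_cancel₀ (hv0 n).ne', one_mul]) hT hA t
  rw [hvar] at hlim
  have hgauss : charFun ((gaussianReal 0 (limitVar κ₁ κ₂ κ₃ σ c ρ).toNNReal).map id) t =
      Complex.exp ((-(t ^ 2 / 2 * limitVar κ₁ κ₂ κ₃ σ c ρ) : ℝ)) := by
    rw [Measure.map_id, charFun_gaussianReal, Real.coe_toNNReal _ hvar0]
    congr 1
    push_cast
    ring
  refine (hlim.congr fun n => ?_).trans (le_of_eq (by rw [← hgauss]; rfl))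
  have hpow : (n : ℝ) ^ (3 / 2 : ℝ) = √n ^ 3 := by
    rw [Real.sqrt_eq_rpow, ← Real.rpow_natCast, ← Real.rpow_mul (Nat.cast_nonneg n)]
    norm_num
  have hmap : (P n).map (fun ω : Ω n =>
      (sqNormXtY (X n ω) (Y n ω) - (n : ℝ) ^ 2 * kappa2 β ρ (p n)
        - (p n : ℝ) * (n : ℝ) * (kappa1 β ρ (p n) + σ ^ 2)) / (n : ℝ) ^ (3 / 2 : ℝ)) =
      ((Measure.pi fun _ : Fin (p n) => gaussianReal 0 1).prod
        (Measure.pi fun _ : Fin n => gaussianReal 0 1)).map (fun z =>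
        (quadStat (√(v n)) (kappa2 β ρ (p n)) (a n) (lam n) z -
          (n : ℝ) ^ 2 * kappa2 β ρ (p n) - p n * n * v n) / √n ^ 3) := by
    have hφ : Measurable fun x : ℝ => (x - (n : ℝ) ^ 2 * kappa2 β ρ (p n)
        - (p n : ℝ) * (n : ℝ) * (kappa1 β ρ (p n) + σ ^ 2)) / (n : ℝ) ^ (3 / 2 : ℝ) := by fun_prop
    have h1 := congrArg (fun μ => μ.map fun x : ℝ => (x - (n : ℝ) ^ 2 * kappa2 β ρ (p n)
        - (p n : ℝ) * (n : ℝ) * (kappa1 β ρ (p n) + σ ^ 2)) / (n : ℝ) ^ (3 / 2 : ℝ)) (hlaw n)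
    rw [AEMeasurable.map_map_of_aemeasurable hφ.aemeasurable (hmeas n),
      Measure.map_map hφ (by fun_prop)] at h1
    rw [← hpow]
    exact h1
  change _ = charFun ((P n).map _) t
  rw [hmap, charFun_apply_real, integral_map (Measurable.aemeasurable (by fun_prop))
    (Measurable.aestronglyMeasurable (by fun_prop))]
  push_cast
  rfl
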